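/- Let $P_1,P_2,P_3$ be three distinct points of the sphere $\mathbb{S}^2$ and $\Sigma=\mathbb{S}^2\setminus\{P_1,P_2,P_3\}$; indices $i\in\{1,2,3\}$ are taken modulo $3$. A simple closed curve $C\subset\Sigma$ is of type $i$ if one of the components of $\mathbb{S}^2\setminus C$ contains $P_i$ and another one contains both $P_{i+1}$ and $P_{i+2}$. Let $G$ be a $\Sigma$-graph, that is, a finite connected nonempty graph embedded in $\mathbb{S}^2$ (multiple edges and self-loops allowed) such that $P_1,P_2,P_3$ do not lie on $G$ and lie in three distinct faces $F_1,F_2,F_3$ of $G$, where the faces of $G$ are the connected components of $\mathbb{S}^2\setminus G$. A simple loop on $G$ is a simple closed curve that is a union of edges of $G$; simple loops on $G$ are called disjoint if they have no vertex of $G$ in common. A lamination of $G$ is a (possibly empty) collection of pairwise disjoint simple loops on $G$, each of them non-contractible in $\Sigma$, and the lamination space $\mathcal{L}(G)$ is the set of all triples $(m_1,m_2,m_3)$ of non-negative integers such that some lamination of $G$ contains, for every $i$, exactly $m_i$ loops of type $i$. Let $M_i(G)$ be the maximal number of pairwise disjoint simple loops of type $i$ on $G$. Let $d_i(G)$ be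 the distance between $F_{i+1}$ and $F_{i+2}$ in the graph whose vertices are the faces of $G$, two distinct faces being adjacent if they share an edge or a vertex of $G$. Then the maxima $M_i(G)$ exist, the distances $d_i(G)$ are finite and positive, and \[ \mathcal{L}(G)=\bigl\{(m_1,m_2,m_3)\in\mathbb{Z}_{\ge 0}^3 \;:\; m_i\le M_i(G)\ \text{ and }\ m_{i+1}+m_{i+2}\le d_i(G)\ \text{ for all } i\in\{1,2,3\}\bigr\}. \] -/

import Mathlib

namespace Pants

/-- The sphere `S²`, as the unit sphere of Euclidean 3-space. -/
abbrev S2 : Type := Metric.sphere (0 : EuclideanSpace ℝ (Fin 3)) 1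

/-- A graph embedded in `S²`, with edges indexed by `ι`; self-loops and multiple edges are allowed.
Vertices are points, and edges are arcs (closed curves through one vertex, for self-loops) joining
vertices, whose relative interiors contain no vertex and are pairwise disjoint. -/
structure EmbeddedGraph (ι : Type*) where
  /-- the vertices -/
  vert : Finset S2
  /-- the closed edges, parametrized by the unit interval -/
  arc : ι → C(unitInterval, S2)
  arc_zero_mem : ∀ e, arc e 0 ∈ vert
  arc_one_mem : ∀ e, arc e 1 ∈ vert
  arc_injOn : ∀ e, Set.InjOn (arc e) (Set.Ioo 0 1)
  arc_notMem_vert : ∀ e, ∀ t ∈ Set.Ioo (0 : unitInterval) 1, arc e t ∉ vert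
  arc_disjoint : ∀ e e', e ≠ e' →
    Disjoint (arc e '' Set.Ioo 0 1) (arc e' '' Set.Ioo 0 1)

/-- The three-holed sphere `Σ`: the sphere without the three points `P 0, P 1, P 2`. -/
abbrev Holed (P : Fin 3 → S2) : Type := {x : S2 // ∀ i, x ≠ P i}

/-- `C` is (the image of) a simple closed curve on the sphere. -/
def IsSimpleClosedCurve (C : Set S2) : Prop :=
  ∃ f : C(Circle, S2), Function.Injective f ∧ Set.range f = C

/-- The connected component of `S² \ C` that contains `x` (for `x ∉ C`). -/
def side (C : Set S2) (x : S2) : Set S2 := connectedComponentIn Cᶜ x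

/-- `C` avoids the punctures, and one of the components of its complement contains `P i` while
another one contains the two other punctures. Indices are taken modulo 3. -/
def IsOfType (P : Fin 3 → S2) (i : Fin 3) (C : Set S2) : Prop :=
  (∀ j, P j ∉ C) ∧ side C (P (i + 1)) = side C (P (i + 2)) ∧ side C (P i) ≠ side C (P (i + 1))

/-- The simple closed curve `C` lies in `Σ` and can be contracted to a point in `Σ`. -/
def IsContractible (P : Fin 3 → S2) (C : Set S2) : Prop :=
  ∃ f : C(Circle, Holed P), Function.Injective f ∧
    Set.range (fun z => (f z : S2)) = C ∧ f.Nullhomotopic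

namespace EmbeddedGraph

variable {ι : Type*} (G : EmbeddedGraph ι)

/-- The set of points of the sphere covered by the graph. -/
def carrier : Set S2 := (G.vert : Set S2) ∪ ⋃ e, Set.range (G.arc e)

/-- The faces: the connected components of the complement of the graph. -/
def faces : Set (Set S2) := {F | ∃ x ∈ G.carrierᶜ, F = side G.carrier x}

/-- Two faces share a vertex (a vertex incident to both). -/
def ShareVertex (F F' : Set S2) : Prop := ∃ v ∈ G.vert, v ∈ closure F ∧ v ∈ closure F'

/-- Two faces share an edge (an edge incident to both). -/
def ShareEdge (F F' : Set S2) : Prop :=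
  ∃ e, Set.range (G.arc e) ⊆ closure F ∧ Set.range (G.arc e) ⊆ closure F'

/-- The graph on the faces that underlies the face distance: the dual graph, together with an edge
between any two distinct faces that share a vertex. -/
def faceGraph : SimpleGraph G.faces where
  Adj F F' := F ≠ F' ∧ (G.ShareEdge F F' ∨ G.ShareVertex F F')
  symm := ⟨fun _ _ h => ⟨h.1.symm, h.2.imp (fun ⟨e, h₁, h₂⟩ => ⟨e, h₂, h₁⟩)
    (fun ⟨v, hv, h₁, h₂⟩ => ⟨v, hv, h₂, h₁⟩)⟩⟩
  loopless := ⟨fun _ h => h.1 rfl⟩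

/-- `C` is a simple loop on `G`: a simple closed curve made up of edges of `G`. -/
def IsSimpleLoop (C : Set S2) : Prop :=
  IsSimpleClosedCurve C ∧ ∃ S : Set ι, C = ⋃ e ∈ S, Set.range (G.arc e)

/-- The members of `L` pairwise have no vertex of `G` in common. -/
def VertexDisjoint (L : Set (Set S2)) : Prop :=
  L.Pairwise fun C C' => ∀ v ∈ G.vert, ¬ (v ∈ C ∧ v ∈ C')

/-- A lamination of `G`: a collection of pairwise vertex-disjoint simple loops on `G`, each of them
non-contractible on `Σ`. -/
def IsLamination (P : Fin 3 → S2) (L : Set (Set S2)) : Prop :=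
  (∀ C ∈ L, G.IsSimpleLoop C ∧ ¬ IsContractible P C) ∧ G.VertexDisjoint L

/-- The lamination space: all `m` such that `G` has a lamination that contains, for each `i`,
exactly `m i` loops of type `i`. -/
def laminationSpace (P : Fin 3 → S2) : Set (Fin 3 → ℕ) :=
  {m | ∃ L, G.IsLamination P L ∧ ∀ i, {C ∈ L | IsOfType P i C}.encard = m i}

/-- The numbers of loops in families of pairwise vertex-disjoint simple loops of type `i`. -/
def loopCounts (P : Fin 3 → S2) (i : Fin 3) : Set ℕ :=
  {n | ∃ L : Set (Set S2), (∀ C ∈ L, G.IsSimpleLoop C ∧ IsOfType P i C) ∧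
    G.VertexDisjoint L ∧ L.encard = n}

/-- The maximal number of pairwise disjoint simple loops of type `i` on `G`. -/
noncomputable def maxLoops (P : Fin 3 → S2) (i : Fin 3) : ℕ := sSup (G.loopCounts P i)

/-- `G` is a connected nonempty graph, and the punctures lie in three distinct faces of `G`. -/
structure IsSigmaGraph (P : Fin 3 → S2) : Prop where
  isConnected : IsConnected G.carrier
  notMem_carrier : ∀ i, P i ∉ G.carrier
  side_injective : Function.Injective fun i => side G.carrier (P i)

variable {G}

/-- The marked face that contains the puncture `P i`. -/
def IsSigmaGraph.markedFace {P : Fin 3 → S2} (h : G.IsSigmaGraph P) (i : Fin 3) : G.faces :=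
  ⟨side G.carrier (P i), P i, h.notMem_carrier i, rfl⟩

/-- The face distance between the two marked faces other than the `i`-th one
(`SimpleGraph.dist` is the length of a shortest path, and `0` if there is no path). -/
noncomputable def IsSigmaGraph.markedDist {P : Fin 3 → S2} (h : G.IsSigmaGraph P) (i : Fin 3) : ℕ :=
  G.faceGraph.dist (h.markedFace (i + 1)) (h.markedFace (i + 2))

end EmbeddedGraph

/-- The set of the integer points cut out by `0 ≤ m i ≤ a i` and `m (i+1) + m (i+2) ≤ d i`,
indices modulo 3. -/
def latticePolytope (a d : Fin 3 → ℕ) : Set (Fin 3 → ℕ) :=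
  {m | ∀ i, m i ≤ a i ∧ m (i + 1) + m (i + 2) ≤ d i}

end Pants

/-! Necessity of the inequalities: a loop of type `i+1` or `i+2` separates `F_{i+1}` from `F_{i+2}`.
Consecutive faces of a face path share a vertex, and a loop that avoids this vertex has both faces
on the same side. So each separating loop passes through the vertex of some step, while by
disjointness a step serves at most one loop (`encard_le_length`).

Sufficiency: for `k < M_i`, consider the faces at distance at most `k` from `F_i`. All faces beyond
the outermost of `M_i` disjoint loops of type `i` have distance at least `M_i`, so the other two
punctures lie in one component of the complement of the closed union of the chosen faces. The
frontier of that component lies on `G` and contains a simple loop of type `i` (`exists_levelLoop`),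
each of whose points touches a face at distance at most `k` and one at distance more than `k`. Since
faces at a common vertex have distances differing by at most 1, level loops for different `k` are
disjoint, and `m_i + m_j ≤ dist(F_i, F_j)` keeps the first `m_i` level loops around `F_i` away from
the first `m_j` around `F_j`.

The topology rests on Eilenberg's criterion, not on the Jordan curve theorem: a closed set `X`
separates `p` from the point at infinity if and only if `z - p` has no continuous logarithm on `X`.
On a graph, logarithms can be built edge by edge, and the only obstruction is a simple cycle. Hence
a closed part of `G` that separates two points contains a simple loop that does
(`exists_isSimpleLoop_side_ne`). The same criterion gives the finiteness of the set of faces. -/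

namespace Pants

open Complex Set Filter Topology

/-! ### Continuous logarithms -/

section Logarithms

variable {Y Z : Type*} [TopologicalSpace Y] [TopologicalSpace Z]

/-- `f` has a continuous logarithm on `X`. -/
def HasLog (f : Y → ℂ) (X : Set Y) : Prop :=
  ∃ g : Y → ℂ, ContinuousOn g X ∧ ∀ x ∈ X, exp (g x) = f x

theorem HasLog.mono {f : Y → ℂ} {X X' : Set Y} (h : HasLog f X) (hX : X' ⊆ X) : HasLog f X' :=
  let ⟨g, hg, e⟩ := h
  ⟨g, hg.mono hX, fun x hx => e x (hX hx)⟩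

theorem HasLog.congr {f f' : Y → ℂ} {X : Set Y} (h : HasLog f X) (hf : ∀ x ∈ X, f x = f' x) :
    HasLog f' X :=
  let ⟨g, hg, e⟩ := h
  ⟨g, hg, fun x hx => (e x hx).trans (hf x hx)⟩

theorem HasLog.mul {f f' : Y → ℂ} {X : Set Y} (h : HasLog f X) (h' : HasLog f' X) :
    HasLog (fun x => f x * f' x) X :=
  let ⟨g, hg, e⟩ := h
  let ⟨g', hg', e'⟩ := h'
  ⟨fun x => g x + g' x, hg.add hg', fun x hx => by rw [exp_add, e x hx, e' x hx]⟩

theorem HasLog.zpow {f : Y → ℂ} {X : Set Y} (h : HasLog f X) (n : ℤ) :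
    HasLog (fun x => f x ^ n) X :=
  let ⟨g, hg, e⟩ := h
  ⟨fun x => n * g x, continuousOn_const.mul hg, fun x hx => by rw [exp_int_mul, e x hx]⟩

theorem hasLog_const {c : ℂ} (hc : c ≠ 0) (X : Set Y) : HasLog (fun _ => c) X :=
  ⟨fun _ => log c, continuousOn_const, fun _ _ => exp_log hc⟩

theorem HasLog.comp {f : Y → ℂ} {X : Set Y} (h : HasLog f X) {φ : Z → Y} {T : Set Z}
    (hφ : ContinuousOn φ T) (hT : MapsTo φ T X) : HasLog (fun t => f (φ t)) T :=
  let ⟨g, hg, e⟩ := h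
  ⟨fun t => g (φ t), hg.comp hφ hT, fun _ ht => e _ (hT ht)⟩

theorem hasLog_of_norm_sub_one_lt {f : Y → ℂ} {X : Set Y} (hf : ContinuousOn f X)
    (h : ∀ x ∈ X, ‖f x - 1‖ < 1) : HasLog f X := by
  have hs : ∀ x ∈ X, f x ∈ slitPlane := fun x hx => by
    have := mem_slitPlane_of_norm_lt_one (h x hx)
    simpa using this
  exact ⟨fun x => log (f x), hf.clog hs, fun x hx => exp_log (slitPlane_ne_zero (hs x hx))⟩

theorem exists_log_of_simplyConnected [SimplyConnectedSpace Y] [LocallyPathConnectedSpace Y]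
    {f : Y → ℂ} (hf : Continuous f) (h0 : ∀ x, f x ≠ 0) :
    ∃ g : Y → ℂ, Continuous g ∧ ∀ x, exp (g x) = f x := by
  obtain ⟨y⟩ : Nonempty Y := inferInstance
  obtain ⟨F, ⟨-, hF⟩, -⟩ := isCoveringMap_exp.existsUnique_continuousMap_lifts
    (⟨fun x => ⟨f x, h0 x⟩, by fun_prop⟩ : C(Y, {z : ℂ // z ≠ 0})) y (log (f y))
    (Subtype.ext (exp_log (h0 y)))
  exact ⟨F, F.continuous, fun x => congrArg Subtype.val (congrFun hF x)⟩

theorem exists_log_unitInterval {f : unitInterval → ℂ} (hf : Continuous f) (h0 : ∀ x, f x ≠ 0) :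
    ∃ g : unitInterval → ℂ, Continuous g ∧ ∀ x, exp (g x) = f x := by
  obtain ⟨g, hg, e⟩ := exists_log_of_simplyConnected (Y := ℝ)
    (f := IccExtend zero_le_one f) hf.Icc_extend' (fun x => h0 _)
  exact ⟨fun t => g t, by fun_prop, fun t => by rw [e]; simp⟩

/-- The difference of the two logarithms has values in a countable, hence totally disconnected set,
so it is constant on a connected set. -/
theorem exists_int_of_exp_eq {X : Set Y} (hX : IsPreconnected X) {g h : Y → ℂ}
    (hg : ContinuousOn g X) (hh : ContinuousOn h X) (e : ∀ x ∈ X, exp (g x) = exp (h x)) :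
    ∃ n : ℤ, ∀ x ∈ X, g x = h x + n * (2 * Real.pi * I) := by
  rcases X.eq_empty_or_nonempty with rfl | ⟨x₀, h₀⟩
  · exact ⟨0, by simp⟩
  obtain ⟨n, hn⟩ := exp_eq_exp_iff_exists_int.1 (e x₀ h₀)
  refine ⟨n, fun x hx => ?_⟩
  have hsub : ((fun x => g x - h x) '' X).Subsingleton := by
    refine (Set.Countable.isTotallyDisconnected
      (countable_range fun n : ℤ => (n : ℂ) * (2 * Real.pi * I))) _ ?_ (hX.image _ (hg.sub hh))
    rintro _ ⟨y, hy, rfl⟩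
    obtain ⟨m, hm⟩ := exp_eq_exp_iff_exists_int.1 (e y hy)
    exact ⟨m, by simp [hm]⟩
  have := hsub (mem_image_of_mem _ hx) (mem_image_of_mem _ h₀)
  simp only [hn] at this
  linear_combination this

/-- A nonzero power of the coordinate has no logarithm on a circle around the origin. -/
theorem eq_zero_of_hasLog_zpow_sphere {R : ℝ} (hR : 0 < R) {n : ℤ}
    (h : HasLog (fun z : ℂ => z ^ n) (Metric.sphere 0 R)) : n = 0 := by
  obtain ⟨g, hg, e⟩ := h
  have hmem : ∀ θ : ℝ, (R : ℂ) * exp (θ * I) ∈ Metric.sphere (0 : ℂ) R := fun θ => by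
    simp [norm_exp_ofReal_mul_I, abs_of_pos hR]
  have hR' : (R : ℂ) ≠ 0 := by exact_mod_cast hR.ne'
  -- Along the circle the logarithm differs from `n (log R + iθ)` by a constant; the parameters `0`
  -- and `2π` give the same point, which forces `2πin = 0`.
  obtain ⟨m, hm⟩ := exists_int_of_exp_eq (X := (univ : Set ℝ)) isPreconnected_univ
    (g := fun θ => g (R * exp (θ * I))) (h := fun θ => n * (log R + θ * I))
    (hg.comp (by fun_prop) fun θ _ => hmem θ) (by fun_prop) (fun θ _ => by
      rw [e _ (hmem θ), exp_int_mul, exp_add, exp_log hR'])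
  have h0 := hm 0 trivial
  have h1 := hm (2 * Real.pi) trivial
  simp only [ofReal_zero, zero_mul, exp_zero, ofReal_mul, ofReal_ofNat, exp_two_pi_mul_I] at h0 h1
  rw [h0] at h1
  have : (n : ℂ) * (2 * Real.pi * I) = 0 := by linear_combination -h1
  simpa [Real.pi_ne_zero] using this

theorem continuousOn_piecewise_union {A B : Set Y} (hA : IsClosed A) (hB : IsClosed B)
    [∀ x, Decidable (x ∈ A)] {f g : Y → ℂ} (hf : ContinuousOn f A) (hg : ContinuousOn g B)
    (h : ∀ x ∈ A ∩ B, f x = g x) : ContinuousOn (A.piecewise f g) (A ∪ B) := by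
  refine ContinuousOn.union_of_isClosed (hf.congr fun x hx => piecewise_eq_of_mem _ _ _ hx)
    (hg.congr fun x hx => ?_) hA hB
  by_cases hxA : x ∈ A
  · rw [piecewise_eq_of_mem _ _ _ hxA, h x ⟨hxA, hx⟩]
  · rw [piecewise_eq_of_notMem _ _ _ hxA]

/-- A continuous map from a compact space to a Hausdorff space is closed, so it is a quotient map
onto its range. -/
theorem continuousOn_range_of_comp [CompactSpace Z] [T2Space Y] {W : Type*} [TopologicalSpace W]
    {γ : Z → Y} (hγ : Continuous γ) {g : Y → W} (hg : Continuous fun t => g (γ t)) :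
    ContinuousOn g (range γ) := by
  rw [continuousOn_iff_isClosed]
  intro t ht
  refine ⟨γ '' ((fun t => g (γ t)) ⁻¹' t), ((ht.preimage hg).isCompact.image hγ).isClosed, ?_⟩
  ext y
  constructor
  · rintro ⟨hy, s, rfl⟩
    exact ⟨⟨s, hy, rfl⟩, s, rfl⟩
  · rintro ⟨⟨s, hs, rfl⟩, hy⟩
    exact ⟨hs, hy⟩

/-- A continuous function on `Y` that is homotopic to a constant without zeros has a logarithm. -/
theorem hasLog_of_nullhomotopic {φ : C(Y, Z)} (hφ : φ.Nullhomotopic) {f : Z → ℂ}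
    (hf : Continuous f) (h0 : ∀ z, f z ≠ 0) : HasLog (fun y => f (φ y)) univ := by
  obtain ⟨z, ⟨H⟩⟩ := hφ
  -- The reversed homotopy starts at a constant map, where a logarithm is known; lifting it through
  -- `exp` carries that logarithm to the other end.
  let H' := H.symm
  let K : C(unitInterval × Y, {z : ℂ // z ≠ 0}) := ⟨fun p => ⟨f (H' p), h0 _⟩, by fun_prop⟩
  have hK : ∀ y, K (0, y) = ⟨exp (ContinuousMap.const Y (log (f z)) y), exp_ne_zero _⟩ := fun y =>
    Subtype.ext (by simp [K, H', exp_log (h0 z)])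
  refine ⟨fun y => isCoveringMap_exp.liftHomotopy K _ hK (1, y), by fun_prop, fun y _ => ?_⟩
  have := congrFun (isCoveringMap_exp.liftHomotopy_lifts K _ hK) (1, y)
  simpa [K, H'] using congrArg Subtype.val this

end Logarithms

end Pants

/-! ### Separation of points by closed sets in the sphere, in terms of logarithms -/

namespace Pants

open Complex Set Filter Topology

instance : LocallyConnectedSpace S2 :=
  haveI : Fact (Module.finrank ℝ (EuclideanSpace ℝ (Fin 3)) = 2 + 1) := ⟨by simp⟩
  ChartedSpace.locallyConnectedSpace (EuclideanSpace ℝ (Fin 2)) S2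

instance : ConnectedSpace S2 :=
  isConnected_iff_connectedSpace.1 (isConnected_sphere
    (by rw [← Module.finrank_eq_rank]; norm_cast; simp) _ zero_le_one)

section Sides

variable {C X : Set S2} {x y : S2}

theorem mem_side (hx : x ∉ C) : x ∈ side C x := mem_connectedComponentIn hx

theorem side_subset : side C x ⊆ Cᶜ := connectedComponentIn_subset _ _

theorem isPreconnected_side : IsPreconnected (side C x) := isPreconnected_connectedComponentIn

theorem isOpen_side (hC : IsClosed C) : IsOpen (side C x) := hC.isOpen_compl.connectedComponentIn

theorem side_eq_of_mem (h : y ∈ side C x) : side C x = side C y := connectedComponentIn_eq h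

theorem side_eq_iff (hy : y ∉ C) : side C x = side C y ↔ y ∈ side C x :=
  ⟨fun h => h ▸ mem_side hy, side_eq_of_mem⟩

theorem subset_side {S : Set S2} (hS : IsPreconnected S) (hx : x ∈ S) (h : Disjoint S C) :
    S ⊆ side C x :=
  hS.subset_connectedComponentIn hx h.subset_compl_right

theorem disjoint_side (h : side C x ≠ side C y) : Disjoint (side C x) (side C y) :=
  disjoint_left.2 fun _ hx hy => h ((side_eq_of_mem hx).trans (side_eq_of_mem hy).symm)

theorem isClosed_side_union (hC : IsClosed C) : IsClosed (side C x ∪ C) := by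
  rw [← isOpen_compl_iff, isOpen_iff_mem_nhds]
  intro y hy
  rw [compl_union] at hy
  refine mem_of_superset ((isOpen_side hC).mem_nhds (mem_side hy.2)) fun z hz => ?_
  rw [compl_union]
  exact ⟨fun h => hy.1 ((side_eq_iff hy.2).1 ((side_eq_of_mem h).trans (side_eq_of_mem hz).symm)),
    side_subset hz⟩

theorem closure_side_subset (hC : IsClosed C) : closure (side C x) ⊆ side C x ∪ C :=
  closure_minimal subset_union_left (isClosed_side_union hC)

end Sides

/-- A coordinate on the sphere without the point `N`. -/
structure PlaneChart (N : S2) where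
  /-- the coordinate of a point -/
  coord : S2 → ℂ
  /-- the point with given coordinate -/
  point : ℂ → S2
  continuousOn_coord : ContinuousOn coord {N}ᶜ
  continuous_point : Continuous point
  coord_point : ∀ z, coord (point z) = z
  point_coord : ∀ x, x ≠ N → point (coord x) = x
  point_ne : ∀ z, point z ≠ N
  exists_radius : ∀ O ∈ 𝓝 N, ∃ R : ℝ, 0 < R ∧ ∀ z, R ≤ ‖z‖ → point z ∈ O

theorem nonempty_planeChart (N : S2) : Nonempty (PlaneChart N) := by
  have hN : ‖(N : EuclideanSpace ℝ (Fin 3))‖ = 1 := by simp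
  have hN0 : (N : EuclideanSpace ℝ (Fin 3)) ≠ 0 := fun h => by simp [h] at hN
  have : Fact (Module.finrank ℝ (EuclideanSpace ℝ (Fin 3)) = 2 + 1) := ⟨by simp⟩
  have hV : Module.finrank ℝ ℂ =
      Module.finrank ℝ (Submodule.span ℝ {(N : EuclideanSpace ℝ (Fin 3))})ᗮ := by
    rw [finrank_real_complex, Submodule.finrank_orthogonal_span_singleton (𝕜 := ℝ) (n := 2) hN0]
  let e : ℂ ≃L[ℝ] (Submodule.span ℝ {(N : EuclideanSpace ℝ (Fin 3))})ᗮ :=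
    (FiniteDimensional.nonempty_continuousLinearEquiv_of_finrank_eq hV).some
  let ρ : ℂ → S2 := fun z => (stereographic hN).symm (e z)
  have hρ : IsOpenEmbedding ρ :=
    (isOpenEmbedding_stereographic_symm hN).comp e.toHomeomorph.isOpenEmbedding
  have hr : range ρ = {N}ᶜ := by
    change range ((stereographic hN).symm ∘ e) = _
    rw [e.surjective.range_comp]
    exact range_stereographic_symm hN N.2
  have hl : ∀ z, Function.invFun ρ (ρ z) = z := Function.leftInverse_invFun hρ.injective
  refine ⟨⟨Function.invFun ρ, ρ, ?_, hρ.continuous, hl, fun x hx => ?_, fun z => ?_, ?_⟩⟩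
  · rw [← hr]
    rintro _ ⟨z, rfl⟩
    refine (hρ.continuousAt_iff.1 ?_).continuousWithinAt
    convert continuousAt_id using 1
    exact funext hl
  · exact Function.invFun_eq (f := ρ) (show x ∈ range ρ by rw [hr]; exact hx)
  · have : ρ z ∈ ({N}ᶜ : Set S2) := hr ▸ mem_range_self z
    exact this
  · intro O hO
    have hK : IsCompact ((interior O)ᶜ) := isOpen_interior.isClosed_compl.isCompact
    have hsub : (interior O)ᶜ ⊆ range ρ := by
      rw [hr]
      exact compl_subset_compl.2 (singleton_subset_iff.2 (mem_interior_iff_mem_nhds.2 hO))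
    have hK' := hρ.toIsEmbedding.isCompact_preimage_iff hsub |>.2 hK
    obtain ⟨R, hR⟩ := hK'.isBounded.exists_norm_le
    refine ⟨max R 0 + 1, by positivity, fun z hz => ?_⟩
    by_contra h
    have := hR z (fun h' => h (interior_subset h'))
    linarith [le_max_left R 0]

namespace PlaneChart

variable {N : S2} (c : PlaneChart N) {X : Set S2}

theorem coord_ne {x y : S2} (hx : x ≠ N) (hy : y ≠ N) (h : x ≠ y) : c.coord x - c.coord y ≠ 0 :=
  fun e => h (by rw [← c.point_coord x hx, sub_eq_zero.1 e, c.point_coord y hy])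

/-- On a large circle `1 - p / z` stays within distance 1 of 1 and has a logarithm, so the centre
can be moved from `p` to the origin. -/
theorem hasLog_sub_zpow {p : ℂ} {R : ℝ} (hR : 2 * ‖p‖ < R) (n : ℤ)
    (h : HasLog (fun z : ℂ => (z - p) ^ n) (Metric.sphere 0 R)) :
    HasLog (fun z : ℂ => z ^ n) (Metric.sphere 0 R) := by
  have h0 : ∀ z ∈ Metric.sphere (0 : ℂ) R, z ≠ 0 := by
    rintro z hz rfl
    simp only [mem_sphere_iff_norm, sub_zero, norm_zero] at hz
    linarith [norm_nonneg p]
  have h1 : HasLog (fun z : ℂ => 1 - p / z) (Metric.sphere 0 R) := by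
    refine hasLog_of_norm_sub_one_lt
      (continuousOn_const.sub (continuousOn_const.div continuousOn_id h0)) fun z hz => ?_
    have hz' : ‖z‖ = R := by simpa using hz
    have : ‖1 - p / z - 1‖ = ‖p‖ / R := by rw [← hz', ← norm_div, ← norm_neg]; congr 1; ring
    rw [this, div_lt_one (by linarith [norm_nonneg p])]
    linarith [norm_nonneg p]
  refine (h.mul (h1.zpow (-n))).congr fun z hz => ?_
  have hz' : ‖z‖ = R := by simpa using hz
  have hzp : z - p ≠ 0 := fun e => by
    rw [sub_eq_zero.1 e] at hz'
    linarith [norm_nonneg p]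
  have : 1 - p / z = (z - p) / z := by rw [sub_div, div_self (h0 z hz)]
  rw [this, div_zpow, zpow_neg, zpow_neg]
  have := zpow_ne_zero n hzp
  have := zpow_ne_zero n (h0 z hz)
  field_simp

/-- The components of the complement of `X` give independent classes of functions without zeros on
`X` modulo exponentials. -/
theorem eq_zero_of_hasLog_prod {κ : Type*} [DecidableEq κ] (hX : IsClosed X) (hN : N ∉ X)
    (s : Finset κ) (p : κ → S2) (a : κ → ℤ) {k : κ} (hk : k ∈ s) (hpN : ∀ j ∈ s, p j ≠ N)
    (hkX : p k ∉ X)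
    (hkN : side X (p k) ≠ side X N) (hp : ∀ j ∈ s, j ≠ k → p j ∉ side X (p k) ∪ X)
    (h : HasLog (fun x => ∏ j ∈ s, (c.coord x - c.coord (p j)) ^ a j) X) : a k = 0 := by
  classical
  obtain ⟨g₀, hg₀, e₀⟩ := h
  -- Tietze: the logarithm extends from `X` to a continuous function on the whole sphere.
  obtain ⟨g, hg⟩ := ContinuousMap.exists_restrict_eq hX ⟨X.domRestrict g₀, hg₀.domRestrict⟩
  have hgX : ∀ x ∈ X, g x = g₀ x := fun x hx => DFunLike.congr_fun hg ⟨x, hx⟩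
  set W := side X (p k)
  -- `F` has no zeros or poles on `W ∪ X`, which contains no `p j` with `j ≠ k`, and `H` has none
  -- off `W`, which contains `p k`. They agree on `X`, so they glue to a continuous function without
  -- zeros on the plane. It has a logarithm, and near infinity it is `H`, whence `a k = 0`.
  let F : ℂ → ℂ := fun z =>
    exp (g (c.point z)) * ∏ j ∈ s.erase k, (z - c.coord (p j)) ^ (-a j)
  let H : ℂ → ℂ := fun z => (z - c.coord (p k)) ^ a k
  let A : Set ℂ := c.point ⁻¹' (W ∪ X)
  let B : Set ℂ := c.point ⁻¹' Wᶜ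
  have hA : IsClosed A := (isClosed_side_union hX).preimage c.continuous_point
  have hB : IsClosed B := (isOpen_side hX).isClosed_compl.preimage c.continuous_point
  have hne : ∀ z ∈ A, ∀ j ∈ s.erase k, z - c.coord (p j) ≠ 0 := by
    intro z hz j hj e
    obtain ⟨hjk, hj⟩ := Finset.mem_erase.1 hj
    refine hp j hj hjk ?_
    rw [← c.point_coord (p j) (hpN j hj), ← sub_eq_zero.1 e]
    exact hz
  have hne' : ∀ z ∈ B, z - c.coord (p k) ≠ 0 := by
    intro z hz e
    refine hz ?_
    rw [sub_eq_zero.1 e, c.point_coord (p k) (hpN k hk)]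
    exact mem_side hkX
  have hF : ContinuousOn F A := by
    refine ContinuousOn.mul (continuous_exp.comp
      (g.continuous.comp c.continuous_point)).continuousOn (continuousOn_finsetProd _ ?_)
    exact fun j hj => ContinuousOn.zpow₀ (by fun_prop) _ fun z hz => Or.inl (hne z hz j hj)
  have hH : ContinuousOn H B :=
    ContinuousOn.zpow₀ (by fun_prop) _ fun z hz => Or.inl (hne' z hz)
  have hAB : ∀ z ∈ A ∩ B, F z = H z := by
    rintro z ⟨hzA, hzB⟩
    have hzX : c.point z ∈ X := hzA.resolve_left hzB
    have := e₀ _ hzX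
    simp only [c.coord_point] at this
    simp only [F, H]
    rw [hgX _ hzX, this, ← Finset.mul_prod_erase s _ hk, mul_assoc, ← Finset.prod_mul_distrib,
      Finset.prod_eq_one, mul_one]
    intro j hj
    rw [← zpow_add₀ (hne z hzA j hj), add_neg_cancel, zpow_zero]
  have hAB' : A ∪ B = univ := by
    ext z
    simp only [A, B, mem_union, mem_preimage, mem_compl_iff, mem_univ, iff_true]
    tauto
  have hcont := continuousOn_piecewise_union hA hB hF hH hAB
  rw [hAB', continuousOn_univ] at hcont
  obtain ⟨l, hl, el⟩ := exists_log_of_simplyConnected hcont fun z => by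
    by_cases hz : z ∈ A
    · rw [piecewise_eq_of_mem _ _ _ hz]
      exact mul_ne_zero (exp_ne_zero _)
        (Finset.prod_ne_zero_iff.2 fun j hj => zpow_ne_zero _ (hne z hz j hj))
    · rw [piecewise_eq_of_notMem _ _ _ hz]
      have hzB : z ∈ B := (hAB' ▸ mem_univ z : z ∈ A ∪ B).resolve_left hz
      exact zpow_ne_zero _ (hne' z hzB)
  obtain ⟨R, hR0, hR⟩ := c.exists_radius _ ((isOpen_side hX).mem_nhds (mem_side hN))
  set R' := max R (2 * ‖c.coord (p k)‖ + 1)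
  have hR' : 0 < R' := lt_max_of_lt_left hR0
  refine eq_zero_of_hasLog_zpow_sphere hR' (hasLog_sub_zpow (p := c.coord (p k))
    (lt_max_of_lt_right (by linarith)) _ ⟨l, hl.continuousOn, fun z hz => ?_⟩)
  have hz' : ‖z‖ = R' := by simpa using hz
  have hzN := hR z (hz' ▸ le_max_left _ _)
  rw [el, piecewise_eq_of_notMem]
  rintro (hzW | hzX)
  · exact disjoint_left.1 (disjoint_side hkN) hzW hzN
  · exact side_subset hzN hzX

/-- If `X` separates `p` from `N`, the coordinate centred at `p` has no logarithm on `X`. -/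
theorem not_hasLog_of_side_ne (hX : IsClosed X) (hN : N ∉ X) {p : S2} (hp : p ∉ X)
    (h : side X p ≠ side X N) : ¬ HasLog (fun x => c.coord x - c.coord p) X := by
  intro hl
  have := c.eq_zero_of_hasLog_prod hX hN {()} (fun _ => p) (fun _ => 1) (k := ()) (by simp)
    (fun _ _ => fun e => h (e ▸ rfl)) hp h (by simp) (by simpa using hl)
  exact one_ne_zero this

/-- If `X` does not separate `p` from `N`, the coordinate centred at `p` has a logarithm on `X`. -/
theorem hasLog_of_side_eq (hX : IsClosed X) (hN : N ∉ X) {p : S2} (hpX : p ∉ X) (hpN : p ≠ N)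
    (h : side X p = side X N) : HasLog (fun x => c.coord x - c.coord p) X := by
  have hXN : ∀ x ∈ X, x ≠ N := fun x hx e => hN (e ▸ hx)
  have hcX : ContinuousOn c.coord X := c.continuousOn_coord.mono fun x hx => hXN x hx
  have hcomp : IsCompact (c.coord '' X) := hX.isCompact.image_of_continuousOn hcX
  -- For `r` close to `q` the quotient `(x - r) / (x - q)` is uniformly close to 1 on the compact
  -- set `X`.
  have hnear : ∀ q, q ∉ X → q ≠ N → ∃ O ∈ 𝓝 q, ∀ r ∈ O, r ≠ N ∧
      HasLog (fun x => (c.coord x - c.coord r) / (c.coord x - c.coord q)) X := by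
    intro q hqX hqN
    have hq : c.coord q ∉ c.coord '' X := by
      rintro ⟨x, hx, e⟩
      exact c.coord_ne (hXN x hx) hqN (fun h => hqX (h ▸ hx)) (sub_eq_zero.2 e)
    obtain ⟨ε, hε, hball⟩ := Metric.isOpen_iff.1 hcomp.isClosed.isOpen_compl _ hq
    have hc : ContinuousAt c.coord q :=
      c.continuousOn_coord.continuousAt (isOpen_compl_singleton.mem_nhds hqN)
    refine ⟨_, inter_mem (hc (Metric.ball_mem_nhds _ hε)) (isOpen_compl_singleton.mem_nhds hqN),
      fun r hr => ⟨hr.2, hasLog_of_norm_sub_one_lt ?_ fun x hx => ?_⟩⟩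
    · exact (hcX.sub continuousOn_const).div (hcX.sub continuousOn_const) fun x hx =>
        c.coord_ne (hXN x hx) hqN (fun h => hqX (h ▸ hx))
    · have h0 := c.coord_ne (hXN x hx) hqN (fun h => hqX (h ▸ hx))
      have h1 : ε ≤ ‖c.coord x - c.coord q‖ := by
        by_contra hlt
        exact hball (by simpa [dist_eq_norm] using hlt) (mem_image_of_mem _ hx)
      have h2 : ‖c.coord r - c.coord q‖ < ε := by simpa [dist_eq_norm] using hr.1
      have : (c.coord x - c.coord r) / (c.coord x - c.coord q) - 1 =
          -((c.coord r - c.coord q) / (c.coord x - c.coord q)) := by field_simp; ring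
      rw [this, norm_neg, norm_div, div_lt_one (hε.trans_le h1)]
      exact h2.trans_le h1
  -- Both `P` and its negation are open conditions off `X`, so `P` is constant on the component of
  -- `N`. It holds at `N` by convention, as no coordinate exists there.
  let P : S2 → Prop := fun q => q = N ∨ HasLog (fun x => c.coord x - c.coord q) X
  have hopen : ∀ q, q ∉ X → q ≠ N → ∀ᶠ r in 𝓝 q, (P r ↔ P q) := by
    intro q hqX hqN
    obtain ⟨O, hO, h⟩ := hnear q hqX hqN
    filter_upwards [hO] with r hr
    obtain ⟨hrN, hl⟩ := h r hr
    have h0 : ∀ x ∈ X, c.coord x - c.coord q ≠ 0 := fun x hx =>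
      c.coord_ne (hXN x hx) hqN (fun h => hqX (h ▸ hx))
    simp only [P, hrN, hqN, false_or]
    constructor
    · intro h'
      have hr0 : ∀ x ∈ X, c.coord x - c.coord r ≠ 0 := fun x hx e => by
        obtain ⟨g, -, e'⟩ := h'
        exact exp_ne_zero _ ((e' x hx).trans e)
      refine (h'.mul (hl.zpow (-1))).congr fun x hx => ?_
      have := h0 x hx
      have := hr0 x hx
      rw [zpow_neg_one]
      field_simp
    · intro h'
      refine (h'.mul hl).congr fun x hx => ?_
      have := h0 x hx
      field_simp
  -- Near `N`, the modulus of `r` exceeds that of all points of `X`, and `x - r = -r (1 - x / r)` is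
  -- a product of functions with logarithms.
  have hPN : ∀ᶠ r in 𝓝 N, P r := by
    obtain ⟨M, hM⟩ := hcomp.isBounded.exists_norm_le
    have hcl : IsClosed (c.point '' Metric.closedBall 0 (max M 0)) :=
      ((isCompact_closedBall _ _).image c.continuous_point).isClosed
    filter_upwards [hcl.isOpen_compl.mem_nhds (by rintro ⟨z, -, hz⟩; exact c.point_ne z hz)]
      with r hr
    by_cases hrN : r = N
    · exact Or.inl hrN
    have hlt : max M 0 < ‖c.coord r‖ := by
      by_contra hle
      exact hr ⟨c.coord r, by simpa only [mem_closedBall_zero_iff, not_lt] using hle, c.point_coord r hrN⟩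
    have hpos : 0 < ‖c.coord r‖ := (le_max_right _ _).trans_lt hlt
    have hr0 : c.coord r ≠ 0 := norm_pos_iff.1 hpos
    have h1 : HasLog (fun x => 1 - c.coord x / c.coord r) X := by
      refine hasLog_of_norm_sub_one_lt (continuousOn_const.sub (hcX.div_const _)) fun x hx => ?_
      have : 1 - c.coord x / c.coord r - 1 = -(c.coord x / c.coord r) := by ring
      rw [this, norm_neg, norm_div, div_lt_one hpos]
      exact (hM _ (mem_image_of_mem _ hx)).trans_lt ((le_max_left _ _).trans_lt hlt)
    refine Or.inr (((hasLog_const (neg_ne_zero.2 hr0) X).mul h1).congr fun x hx => ?_)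
    field_simp
    ring
  have hT : IsOpen (Xᶜ ∩ {q | P q}) := isOpen_iff_mem_nhds.2 fun q hq => by
    refine inter_mem (hX.isOpen_compl.mem_nhds hq.1) ?_
    by_cases hqN : q = N
    · exact hqN ▸ hPN
    · exact (hopen q hq.1 hqN).mono fun r hr => hr.2 hq.2
  have hT' : IsOpen (Xᶜ ∩ {q | ¬ P q}) := isOpen_iff_mem_nhds.2 fun q hq => by
    refine inter_mem (hX.isOpen_compl.mem_nhds hq.1) ?_
    have hqN : q ≠ N := fun e => hq.2 (Or.inl e)
    exact (hopen q hq.1 hqN).mono fun r hr => fun hPr => hq.2 (hr.1 hPr)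
  have hsub : side X N ⊆ Xᶜ ∩ {q | P q} := by
    refine IsPreconnected.subset_left_of_subset_union hT hT' ?_ ?_ ?_ isPreconnected_side
    · exact disjoint_left.2 fun q hq hq' => hq'.2 hq.2
    · intro q hq
      by_cases hPq : P q
      · exact Or.inl ⟨side_subset hq, hPq⟩
      · exact Or.inr ⟨side_subset hq, hPq⟩
    · exact ⟨N, mem_side hN, hN, Or.inl rfl⟩
  exact ((hsub ((side_eq_iff hpX).1 h.symm)).2).resolve_left hpN

end PlaneChart

theorem IsSimpleClosedCurve.isClosed {C : Set S2} (h : IsSimpleClosedCurve C) : IsClosed C := by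
  obtain ⟨f, -, rfl⟩ := h
  exact (isCompact_range f.continuous).isClosed

theorem IsSimpleClosedCurve.isPreconnected {C : Set S2} (h : IsSimpleClosedCurve C) :
    IsPreconnected C := by
  obtain ⟨f, -, rfl⟩ := h
  exact isPreconnected_range f.continuous

/-- A curve that separates two punctures is not contractible. -/
theorem not_isContractible_of_isOfType {P : Fin 3 → S2} {i : Fin 3} {C : Set S2}
    (h : IsOfType P i C) : ¬ IsContractible P C := by
  rintro ⟨f, hf, rfl, hnull⟩
  obtain ⟨hP, -, hne⟩ := h
  have hcl : IsClosed (range fun z => (f z : S2)) := (isCompact_range (by fun_prop)).isClosed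
  -- With `P (i + 1)` at infinity, the coordinate centred at `P i` is finite and nonzero on `Σ`, so
  -- a contraction would give it a logarithm on the curve.
  obtain ⟨c⟩ := nonempty_planeChart (P (i + 1))
  refine c.not_hasLog_of_side_ne hcl (hP _) (hP i) hne ?_
  have hii : P i ≠ P (i + 1) := fun e => hne (by rw [e])
  have hcont : Continuous fun x : Holed P => c.coord x - c.coord (P i) :=
    (c.continuousOn_coord.comp_continuous continuous_subtype_val
      fun x : Holed P => x.2 (i + 1)).sub continuous_const
  obtain ⟨g, hg, e⟩ := hasLog_of_nullhomotopic hnull hcont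
    (fun x => c.coord_ne (x.2 _) hii (x.2 i))
  have hinj : Function.Injective fun z => (f z : S2) := Subtype.val_injective.comp hf
  have hl : ∀ z, Function.invFun (fun z => (f z : S2)) (f z) = z := Function.leftInverse_invFun hinj
  refine ⟨fun x => g (Function.invFun (fun z => (f z : S2)) x),
    continuousOn_range_of_comp (by fun_prop) ?_, ?_⟩
  · simpa only [hl] using continuousOn_univ.1 hg
  · rintro _ ⟨z, rfl⟩
    simpa only [hl] using e z trivial

end Pants

/-! ### Simple closed curves made of paths, and chains of edges -/

namespace Pants

open Complex Set Filter Topology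

/-- The only coincidence of values that a nearly injective path may have is between its ends. -/
def NearlyInjective (γ : unitInterval → S2) : Prop :=
  ∀ s t, γ s = γ t → s = t ∨ (s = 0 ∧ t = 1) ∨ (s = 1 ∧ t = 0)

theorem NearlyInjective.injective {γ : unitInterval → S2} (h : NearlyInjective γ)
    (h01 : γ 0 ≠ γ 1) : Function.Injective γ := by
  intro s t e
  rcases h s t e with h | ⟨rfl, rfl⟩ | ⟨rfl, rfl⟩
  · exact h
  · exact absurd e h01
  · exact absurd e.symm h01

theorem NearlyInjective.isSimpleClosedCurve {γ : unitInterval → S2} (h : NearlyInjective γ)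
    (hγ : Continuous γ) (h01 : γ 0 = γ 1) : IsSimpleClosedCurve (range γ) := by
  -- The circle as the interval with its ends identified; the shift by `π` matches the range of
  -- `Complex.arg`, which gives preimages.
  let e : unitInterval → Circle := fun t => Circle.exp (2 * Real.pi * t - Real.pi)
  have he : Continuous e := by fun_prop
  have hs : Function.Surjective e := by
    intro z
    have h1 := Complex.neg_pi_lt_arg (z : ℂ)
    have h2 := Complex.arg_le_pi (z : ℂ)
    have hpi := Real.pi_pos
    refine ⟨⟨((z : ℂ).arg + Real.pi) / (2 * Real.pi),
      div_nonneg (by linarith) (by linarith), (div_le_one (by linarith)).2 (by linarith)⟩, ?_⟩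
    change Circle.exp _ = z
    rw [mul_div_cancel₀ _ (by positivity), add_sub_cancel_right, Circle.exp_arg]
  have he01 : e 0 = e 1 := Circle.exp_eq_exp.2 ⟨-1, by simp; ring⟩
  have hge : ∀ s t, e s = e t → γ s = γ t := by
    intro s t hst
    obtain ⟨m, hm⟩ := Circle.exp_eq_exp.1 hst
    have hm' : (s : ℝ) = t + m := by
      have hpi := Real.pi_pos.ne'
      have : (2 * Real.pi) * (s - t - m) = 0 := by linear_combination hm
      have := (mul_eq_zero.1 this).resolve_left (by positivity)
      linarith
    have hs0 := s.2.1
    have hs1 := s.2.2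
    have ht0 := t.2.1
    have ht1 := t.2.2
    have hm1 : (m : ℝ) ≤ 1 := by linarith
    have hm2 : (-1 : ℝ) ≤ m := by linarith
    have hm1' : m ≤ 1 := by exact_mod_cast hm1
    have hm2' : -1 ≤ m := by exact_mod_cast hm2
    obtain rfl | rfl | rfl : m = -1 ∨ m = 0 ∨ m = 1 := by omega
    · push_cast at hm'
      have h1 : s = 0 := Subtype.ext (show (s : ℝ) = 0 by linarith)
      have h2 : t = 1 := Subtype.ext (show (t : ℝ) = 1 by linarith)
      rw [h1, h2, h01]
    · rw [show s = t from Subtype.ext (by simpa using hm')]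
    · push_cast at hm'
      have h1 : s = 1 := Subtype.ext (show (s : ℝ) = 1 by linarith)
      have h2 : t = 0 := Subtype.ext (show (t : ℝ) = 0 by linarith)
      rw [h1, h2, h01]
  have hl : ∀ t, γ (Function.surjInv hs (e t)) = γ t := fun t =>
    hge _ _ (Function.surjInv_eq hs (e t))
  refine ⟨⟨fun z => γ (Function.surjInv hs z), ?_⟩, ?_, ?_⟩
  · rw [← continuousOn_univ, ← hs.range_eq]
    exact continuousOn_range_of_comp he (by simpa only [hl] using hγ)
  · intro z w hzw
    rw [← Function.surjInv_eq hs z, ← Function.surjInv_eq hs w]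
    rcases h _ _ hzw with h | ⟨h0, h1⟩ | ⟨h0, h1⟩
    · rw [h]
    · rw [h0, h1, he01]
    · rw [h0, h1, he01]
  · ext x
    constructor
    · rintro ⟨z, rfl⟩
      exact mem_range_self _
    · rintro ⟨t, rfl⟩
      exact ⟨e t, hl t⟩

theorem nearlyInjective_trans {a b c : S2} {p : Path a b} {q : Path b c}
    (hp : Function.Injective p) (hq : Function.Injective q)
    (h : ∀ s t, p s = q t → (s = 1 ∧ t = 0) ∨ (s = 0 ∧ t = 1)) :
    NearlyInjective (p.trans q) := by
  have key : ∀ x y : unitInterval, (x : ℝ) ≤ 1 / 2 → ¬ (y : ℝ) ≤ 1 / 2 →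
      p.trans q x = p.trans q y → x = 0 ∧ y = 1 := by
    intro x y hx hy e
    rw [Path.trans_apply, Path.trans_apply, dif_pos hx, dif_neg hy] at e
    rcases h _ _ e with ⟨-, h2⟩ | ⟨h1, h2⟩
    · have := congrArg Subtype.val h2
      simp at this
      exact absurd (by linarith) hy
    · have h1' := congrArg Subtype.val h1
      have h2' := congrArg Subtype.val h2
      simp at h1' h2'
      exact ⟨h1', Subtype.ext (show (y : ℝ) = 1 by linarith)⟩
  intro x y e
  by_cases hx : (x : ℝ) ≤ 1 / 2 <;> by_cases hy : (y : ℝ) ≤ 1 / 2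
  · rw [Path.trans_apply, Path.trans_apply, dif_pos hx, dif_pos hy] at e
    have := congrArg Subtype.val (hp e)
    simp at this
    exact Or.inl (Subtype.ext this)
  · exact Or.inr (Or.inl (key x y hx hy e))
  · exact Or.inr (Or.inr (key y x hy hx e.symm).symm)
  · rw [Path.trans_apply, Path.trans_apply, dif_neg hx, dif_neg hy] at e
    have := congrArg Subtype.val (hq e)
    simp at this
    exact Or.inl (Subtype.ext this)

/-- A function on `X` and a function along `γ` that agree can be glued. -/
theorem exists_glue {Y T : Type*} [TopologicalSpace Y] [T2Space Y] [TopologicalSpace T]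
    [CompactSpace T] {X : Set Y} (hX : IsClosed X) {g : Y → ℂ} (hg : ContinuousOn g X)
    {γ : T → Y} (hγ : Continuous γ) {h : T → ℂ} (hh : Continuous h)
    (hfac : ∀ s t, γ s = γ t → h s = h t) (hgh : ∀ t, γ t ∈ X → h t = g (γ t)) :
    ∃ g' : Y → ℂ, ContinuousOn g' (X ∪ range γ) ∧ (∀ x ∈ X, g' x = g x) ∧
      ∀ t, g' (γ t) = h t := by
  classical
  have hext : ∀ t, Function.extend γ h 0 (γ t) = h t := fun t =>
    Function.FactorsThrough.extend_apply (fun s t => hfac s t) 0 t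
  have h1 : ContinuousOn (Function.extend γ h 0) (range γ) :=
    continuousOn_range_of_comp hγ (by simpa only [hext] using hh)
  refine ⟨X.piecewise g (Function.extend γ h 0), continuousOn_piecewise_union hX
    (isCompact_range hγ).isClosed hg h1 ?_, fun x hx => piecewise_eq_of_mem _ _ _ hx,
    fun t => ?_⟩
  · rintro _ ⟨hx, t, rfl⟩
    rw [hext, hgh t hx]
  · by_cases ht : γ t ∈ X
    · rw [piecewise_eq_of_mem _ _ _ ht, hgh t ht]
    · rw [piecewise_eq_of_notMem _ _ _ ht, hext]

namespace EmbeddedGraph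

variable {ι : Type*} (G : EmbeddedGraph ι)

theorem nearlyInjective_arc (e : ι) : NearlyInjective (G.arc e) := by
  have hcase : ∀ t : unitInterval, t = 0 ∨ t = 1 ∨ t ∈ Ioo (0 : unitInterval) 1 := by
    intro t
    by_cases h0 : t = 0
    · exact Or.inl h0
    by_cases h1 : t = 1
    · exact Or.inr (Or.inl h1)
    exact Or.inr (Or.inr ⟨unitInterval.pos_iff_ne_zero.2 h0, unitInterval.lt_one_iff_ne_one.2 h1⟩)
  have h0 := G.arc_zero_mem e
  have h1 := G.arc_one_mem e
  have hv := G.arc_notMem_vert e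
  intro s t h
  rcases hcase s with rfl | rfl | hs <;> rcases hcase t with rfl | rfl | ht
  · simp
  · simp
  · exact absurd (h ▸ h0) (hv t ht)
  · simp
  · simp
  · exact absurd (h ▸ h1) (hv t ht)
  · exact absurd (h.symm ▸ h0) (hv s hs)
  · exact absurd (h.symm ▸ h1) (hv s hs)
  · exact Or.inl (G.arc_injOn e hs ht h)

theorem eq_zero_or_one_of_mem_vert {e : ι} {t : unitInterval} (h : G.arc e t ∈ G.vert) :
    t = 0 ∨ t = 1 := by
  by_contra! hc
  exact G.arc_notMem_vert e t ⟨unitInterval.pos_iff_ne_zero.2 hc.1,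
    unitInterval.lt_one_iff_ne_one.2 hc.2⟩ h

theorem mem_vert_of_mem_range {e e' : ι} (hne : e ≠ e') {x : S2} (h : x ∈ range (G.arc e))
    (h' : x ∈ range (G.arc e')) : x ∈ G.vert := by
  obtain ⟨s, rfl⟩ := h
  obtain ⟨t, ht⟩ := h'
  by_contra hx
  have hs : s ∈ Ioo (0 : unitInterval) 1 :=
    ⟨unitInterval.pos_iff_ne_zero.2 fun h => hx (h ▸ G.arc_zero_mem e),
      unitInterval.lt_one_iff_ne_one.2 fun h => hx (h ▸ G.arc_one_mem e)⟩
  have ht' : t ∈ Ioo (0 : unitInterval) 1 :=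
    ⟨unitInterval.pos_iff_ne_zero.2 fun h => hx (ht ▸ h ▸ G.arc_zero_mem e'),
      unitInterval.lt_one_iff_ne_one.2 fun h => hx (ht ▸ h ▸ G.arc_one_mem e')⟩
  exact disjoint_left.1 (G.arc_disjoint e e' hne) (mem_image_of_mem _ hs) ⟨t, ht', ht⟩

/-- The points of the vertices and of the edges in `S`. -/
def sub (S : Set ι) : Set S2 := (G.vert : Set S2) ∪ ⋃ e ∈ S, range (G.arc e)

theorem isClosed_arc (e : ι) : IsClosed (range (G.arc e)) :=
  (isCompact_range (G.arc e).continuous).isClosed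

variable {G}

theorem mem_vert_of_mem_sub {S : Set ι} {e : ι} (he : e ∉ S) {x : S2} (hx : x ∈ range (G.arc e))
    (h : x ∈ G.sub S) : x ∈ G.vert := by
  rcases h with h | h
  · exact h
  · obtain ⟨e', he', h'⟩ := mem_iUnion₂.1 h
    exact G.mem_vert_of_mem_range (fun h : e = e' => he (h ▸ he')) hx h'

theorem isClosed_sub [Finite ι] (S : Set ι) : IsClosed (G.sub S) :=
  G.vert.finite_toSet.isClosed.union (S.toFinite.isClosed_biUnion fun e _ => G.isClosed_arc e)

theorem sub_insert (S : Set ι) (e : ι) : G.sub (insert e S) = G.sub S ∪ range (G.arc e) := by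
  rw [sub, sub, biUnion_insert, union_assoc, union_comm (range _)]

variable (G) in
/-- The edge `e` has the ends `a` and `b`. -/
def Joins (e : ι) (a b : S2) : Prop :=
  (G.arc e 0 = a ∧ G.arc e 1 = b) ∨ (G.arc e 0 = b ∧ G.arc e 1 = a)

theorem Joins.exists_path {e : ι} {a b : S2} (h : G.Joins e a b) :
    ∃ p : Path a b, NearlyInjective p ∧ range p = range (G.arc e) := by
  rcases h with ⟨rfl, rfl⟩ | ⟨rfl, rfl⟩
  · exact ⟨⟨G.arc e, rfl, rfl⟩, G.nearlyInjective_arc e, rfl⟩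
  · refine ⟨Path.symm ⟨G.arc e, rfl, rfl⟩, fun s t h => ?_, Path.symm_range _⟩
    have := G.nearlyInjective_arc e _ _ h
    rw [unitInterval.symm_inj] at this
    rcases this with h | ⟨h, h'⟩ | ⟨h, h'⟩
    · exact Or.inl h
    · exact Or.inr (Or.inr ⟨unitInterval.symm_eq_zero.1 h, unitInterval.symm_eq_one.1 h'⟩)
    · exact Or.inr (Or.inl ⟨unitInterval.symm_eq_one.1 h, unitInterval.symm_eq_zero.1 h'⟩)

theorem Joins.eq_or_eq {e : ι} {a b x : S2} (h : G.Joins e a b) (hx : x ∈ range (G.arc e))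
    (hv : x ∈ G.vert) : x = a ∨ x = b := by
  obtain ⟨t, rfl⟩ := hx
  rcases h with ⟨rfl, rfl⟩ | ⟨rfl, rfl⟩ <;>
    rcases G.eq_zero_or_one_of_mem_vert hv with rfl | rfl <;> simp

theorem Joins.right_mem {e : ι} {a b : S2} (h : G.Joins e a b) : b ∈ range (G.arc e) := by
  rcases h with ⟨-, rfl⟩ | ⟨rfl, -⟩ <;> exact mem_range_self _

theorem Joins.left_mem {e : ι} {a b : S2} (h : G.Joins e a b) : a ∈ range (G.arc e) := by
  rcases h with ⟨rfl, -⟩ | ⟨-, rfl⟩ <;> exact mem_range_self _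

variable (G) in
/-- `G.Chain S a b Y`: the set `Y` is made up of the successive edges, all of them in `S`, of a path
without repeated vertices from `a` to `b`. -/
inductive Chain (S : Set ι) (a : S2) : S2 → Set S2 → Prop
  | nil : Chain S a a {a}
  | snoc {b c : S2} {Y : Set S2} {e : ι} : Chain S a b Y → e ∈ S → G.Joins e b c → c ∉ Y →
      Chain S a c (Y ∪ range (G.arc e))

namespace Chain

variable {S : Set ι} {a b : S2} {Y : Set S2}

theorem right_mem (h : G.Chain S a b Y) : b ∈ Y := by
  cases h with
  | nil => rfl
  | snoc _ _ hj _ => exact Or.inr hj.right_mem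

theorem left_mem (h : G.Chain S a b Y) : a ∈ Y := by
  induction h with
  | nil => rfl
  | snoc _ _ _ _ ih => exact Or.inl ih

theorem exists_of_mem (h : G.Chain S a b Y) {c : S2} (hc : c ∈ Y) (hv : c ∈ G.vert) :
    ∃ Y', G.Chain S a c Y' := by
  induction h with
  | nil => exact ⟨_, by rw [mem_singleton_iff.1 hc]; exact nil⟩
  | @snoc b d Y e h he hj hd ih =>
    by_cases hcY : c ∈ Y
    · exact ih hcY
    · rcases hj.eq_or_eq (hc.resolve_left hcY) hv with rfl | rfl
      · exact ⟨_, h⟩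
      · exact ⟨_, h.snoc he hj hd⟩

theorem exists_of_joins (h : G.Chain S a b Y) {e : ι} (he : e ∈ S) {c : S2} (hj : G.Joins e b c)
    (hc : c ∈ G.vert) : ∃ Y', G.Chain S a c Y' := by
  by_cases hcY : c ∈ Y
  · exact h.exists_of_mem hcY hc
  · exact ⟨_, h.snoc he hj hcY⟩

theorem exists_edges (h : G.Chain S a b Y) :
    ∃ T ⊆ S, Y = {a} ∪ ⋃ e ∈ T, range (G.arc e) := by
  induction h with
  | nil => exact ⟨∅, empty_subset _, by simp⟩
  | @snoc b d Y e _ he _ _ ih =>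
    obtain ⟨T, hT, rfl⟩ := ih
    refine ⟨insert e T, insert_subset he hT, ?_⟩
    rw [biUnion_insert, union_assoc, union_comm (range _)]

theorem mem_vert (h : G.Chain S a b Y) (ha : a ∈ G.vert) {e : ι} (he : ¬ range (G.arc e) ⊆ Y)
    {x : S2} (hx : x ∈ range (G.arc e)) (hxY : x ∈ Y) : x ∈ G.vert := by
  obtain ⟨T, -, rfl⟩ := h.exists_edges
  refine mem_vert_of_mem_sub (S := T) (e := e) (fun h => he ?_) hx ?_
  · exact subset_union_of_subset_right (subset_biUnion_of_mem (u := fun e => range (G.arc e)) h) _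
  · rcases hxY with rfl | h
    · exact Or.inl ha
    · exact Or.inr h

/-- A chain without edges is a point, which is not the range of an injective path; hence the first
alternative. -/
theorem exists_path (h : G.Chain S a b Y) (ha : a ∈ G.vert) :
    (b = a ∧ Y = {a}) ∨ ∃ p : Path a b, Function.Injective p ∧ range p = Y := by
  induction h with
  | nil => exact Or.inl ⟨rfl, rfl⟩
  | @snoc b c Y e h he hj hc ih =>
    right
    obtain ⟨q, hq, hqr⟩ := hj.exists_path
    have hbc : b ≠ c := fun h' => hc (h' ▸ h.right_mem)
    have hqi : Function.Injective q := hq.injective (by rwa [q.source, q.target])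
    rcases ih with ⟨rfl, rfl⟩ | ⟨p, hp, hpr⟩
    · exact ⟨q, hqi, by rw [hqr, eq_comm, union_eq_right]; exact singleton_subset_iff.2 hj.left_mem⟩
    · have hint : ∀ s t, p s = q t → s = 1 ∧ t = 0 := by
        intro s t hst
        have hY : q t ∈ Y := hst ▸ hpr ▸ mem_range_self s
        have he' : q t ∈ range (G.arc e) := hqr ▸ mem_range_self t
        have hv := h.mem_vert ha (fun hs => hc (hs hj.right_mem)) he' hY
        have htb : q t = b := (hj.eq_or_eq he' hv).resolve_right fun h => hc (h ▸ hY)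
        exact ⟨hp (by rw [p.target, hst, htb]), hqi (by rw [q.source, htb])⟩
      refine ⟨p.trans q, (nearlyInjective_trans hp hqi fun s t h => Or.inl (hint s t h)).injective
        ?_, by rw [Path.trans_range, hpr, hqr]⟩
      rw [Path.source, Path.target]
      rintro rfl
      exact hc h.left_mem

theorem isPreconnected (h : G.Chain S a b Y) : IsPreconnected Y := by
  induction h with
  | nil => exact isPreconnected_singleton
  | snoc h _ hj _ ih =>
    exact ih.union _ h.right_mem hj.left_mem (isPreconnected_range (G.arc _).continuous)

/-- A chain and an edge that joins its ends make up a simple closed curve. -/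
theorem isSimpleClosedCurve (h : G.Chain S a b Y) (ha : a ∈ G.vert) {e : ι} (he : e ∉ S)
    (hj : G.Joins e b a) : IsSimpleClosedCurve (Y ∪ range (G.arc e)) := by
  obtain ⟨q, hq, hqr⟩ := hj.exists_path
  rcases h.exists_path ha with ⟨rfl, rfl⟩ | ⟨p, hp, hpr⟩
  · rw [union_eq_right.2 (singleton_subset_iff.2 hj.left_mem), ← hqr]
    exact hq.isSimpleClosedCurve q.continuous (by rw [q.source, q.target])
  · have hab : b ≠ a := by
      rintro rfl
      exact zero_ne_one (hp (p.source.trans p.target.symm))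
    have hqi : Function.Injective q := hq.injective (by rwa [q.source, q.target])
    rw [← hpr, ← hqr, ← Path.trans_range]
    refine (nearlyInjective_trans hp hqi fun s t hst => ?_).isSimpleClosedCurve
      (p.trans q).continuous (by rw [Path.source, Path.target])
    obtain ⟨T, hT, hYT⟩ := h.exists_edges
    have he' : q t ∈ range (G.arc e) := hqr ▸ mem_range_self t
    have hv : q t ∈ G.vert := by
      refine mem_vert_of_mem_sub he he' ?_
      have hY : q t ∈ Y := hst ▸ hpr ▸ mem_range_self s
      rw [hYT] at hY
      rcases hY with hY | hY
      · exact Or.inl (by rw [mem_singleton_iff.1 hY]; exact ha)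
      · exact Or.inr (biUnion_subset_biUnion_left hT hY)
    rcases hj.eq_or_eq he' hv with htb | hta
    · exact Or.inl ⟨hp (by rw [p.target, hst, htb]), hqi (by rw [q.source, htb])⟩
    · exact Or.inr ⟨hp (by rw [p.source, hst, hta]), hqi (by rw [q.target, hta])⟩

end Chain

end EmbeddedGraph

end Pants

/-! ### Logarithms on graphs and separating simple loops -/

namespace Pants

open Complex Set Filter Topology

namespace EmbeddedGraph

variable {ι : Type*} {G : EmbeddedGraph ι}

theorem arc_subset_carrier (e : ι) : range (G.arc e) ⊆ G.carrier :=
  subset_union_of_subset_right (subset_iUnion (fun e => range (G.arc e)) e) _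

theorem vert_subset_carrier : (G.vert : Set S2) ⊆ G.carrier := subset_union_left

theorem carrier_eq_sub : G.carrier = G.sub univ := by simp [carrier, sub]

theorem isClosed_carrier [Finite ι] : IsClosed G.carrier := carrier_eq_sub ▸ isClosed_sub _

theorem exists_log_arc {f : S2 → ℂ} (hf : ContinuousOn f G.carrier) (h0 : ∀ x ∈ G.carrier, f x ≠ 0)
    (e : ι) {w : ℂ} (hw : exp w = f (G.arc e 0)) :
    ∃ h : unitInterval → ℂ, Continuous h ∧ (∀ t, exp (h t) = f (G.arc e t)) ∧ h 0 = w := by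
  have hmem : ∀ t, G.arc e t ∈ G.carrier := fun t => arc_subset_carrier e (mem_range_self t)
  obtain ⟨h, hh, he⟩ := exists_log_unitInterval
    (hf.comp_continuous (G.arc e).continuous hmem) fun t => h0 _ (hmem t)
  refine ⟨fun t => h t - h 0 + w, by fun_prop, fun t => ?_, by ring⟩
  rw [exp_add, exp_sub, he, he, hw]
  exact div_mul_cancel₀ _ (h0 _ (hmem 0))

/-- A logarithm on a set that meets the edge `e` at most in its ends extends along `e` if its values
at the ends fit. -/
theorem exists_log_union_arc {f : S2 → ℂ} {X : Set S2} (hX : IsClosed X) {g : S2 → ℂ}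
    (hg : ContinuousOn g X) (eg : ∀ x ∈ X, exp (g x) = f x) {e : ι} {h : unitInterval → ℂ}
    (hh : Continuous h) (eh : ∀ t, exp (h t) = f (G.arc e t))
    (hXe : ∀ t, G.arc e t ∈ X → t = 0 ∨ t = 1)
    (h0 : h 0 = g (G.arc e 0)) (h1 : h 1 = g (G.arc e 1)) :
    ∃ g' : S2 → ℂ, ContinuousOn g' (X ∪ range (G.arc e)) ∧
      (∀ x ∈ X ∪ range (G.arc e), exp (g' x) = f x) ∧ ∀ x ∈ X, g' x = g x := by
  obtain ⟨g', hg', h2, h3⟩ := exists_glue hX hg (G.arc e).continuous hh (fun s t hst => by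
    rcases G.nearlyInjective_arc e s t hst with rfl | ⟨rfl, rfl⟩ | ⟨rfl, rfl⟩
    · rfl
    · rw [h0, h1, hst]
    · rw [h0, h1, hst]) (fun t ht => by rcases hXe t ht with rfl | rfl <;> assumption)
  refine ⟨g', hg', ?_, h2⟩
  rintro x (hx | ⟨t, rfl⟩)
  · rw [h2 x hx, eg x hx]
  · rw [h3, eh]

/-- If the ends of an edge are not joined by a chain in `S`, a logarithm on `S` can be changed by any
constant near one end without changing it at the other end. -/
theorem exists_log_shift [Finite ι] {S : Set ι} {f g : S2 → ℂ}
    (hg : ContinuousOn g (G.sub S)) (eg : ∀ x ∈ G.sub S, exp (g x) = f x) {a b : S2}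
    (ha : a ∈ G.vert) (hb : b ∈ G.vert) (hab : ∀ Y, ¬ G.Chain S a b Y) {c : ℂ}
    (hc : exp c = 1) : ∃ g' : S2 → ℂ, ContinuousOn g' (G.sub S) ∧
      (∀ x ∈ G.sub S, exp (g' x) = f x) ∧ g' a = g a ∧ g' b = g b + c := by
  classical
  -- The vertices reachable from `a`. They and the remaining vertices, each with the edges of `S`
  -- attached, form two disjoint closed sets `Z R` and `Z Rᶜ` that cover `G.sub S`; the constant is
  -- added on the second one only.
  let R : Set S2 := {v | ∃ Y, G.Chain S a v Y}
  have hR : ∀ e ∈ S, ∀ x ∈ range (G.arc e), x ∈ G.vert → (x ∈ R ↔ G.arc e 0 ∈ R) := by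
    intro e he x hx hv
    obtain ⟨t, rfl⟩ := hx
    rcases G.eq_zero_or_one_of_mem_vert hv with rfl | rfl
    · rfl
    · exact ⟨fun ⟨Y, h⟩ => h.exists_of_joins he (Or.inr ⟨rfl, rfl⟩) (G.arc_zero_mem e),
        fun ⟨Y, h⟩ => h.exists_of_joins he (Or.inl ⟨rfl, rfl⟩) (G.arc_one_mem e)⟩
  let Z : Set S2 → Set S2 := fun Q => (G.vert ∩ Q) ∪
    ⋃ e ∈ {e | e ∈ S ∧ G.arc e 0 ∈ Q}, range (G.arc e)
  have hZ : ∀ Q, IsClosed (Z Q) := fun Q =>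
    (G.vert.finite_toSet.inter_of_left Q).isClosed.union
      ((toFinite _).isClosed_biUnion fun e _ => G.isClosed_arc e)
  have hsub : G.sub S = Z Rᶜ ∪ Z R := by
    ext x
    simp only [sub, Z, mem_union, mem_iUnion₂, mem_inter_iff, Finset.mem_coe, mem_ofPred_eq,
      exists_prop, mem_compl_iff]
    constructor
    · rintro (hx | ⟨e, he, hx⟩)
      · tauto
      · by_cases h : G.arc e 0 ∈ R
        · exact Or.inr (Or.inr ⟨e, ⟨he, h⟩, hx⟩)
        · exact Or.inl (Or.inr ⟨e, ⟨he, h⟩, hx⟩)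
    · rintro ((hx | ⟨e, he, hx⟩) | (hx | ⟨e, he, hx⟩))
      · exact Or.inl hx.1
      · exact Or.inr ⟨e, he.1, hx⟩
      · exact Or.inl hx.1
      · exact Or.inr ⟨e, he.1, hx⟩
  have hdisj : ∀ x ∈ Z Rᶜ ∩ Z R, False := by
    rintro x ⟨h1, h2⟩
    simp only [Z, mem_union, mem_iUnion₂, mem_inter_iff, Finset.mem_coe, mem_ofPred_eq,
      exists_prop, mem_compl_iff] at h1 h2
    rcases h1 with ⟨hv, h1⟩ | ⟨e, ⟨he, h1⟩, hx⟩
    · rcases h2 with ⟨-, h2⟩ | ⟨e, ⟨he, h2⟩, hx⟩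
      · exact h1 h2
      · exact h1 ((hR e he x hx hv).2 h2)
    · rcases h2 with ⟨hv, h2⟩ | ⟨e', ⟨he', h2⟩, hx'⟩
      · exact h1 ((hR e he x hx hv).1 h2)
      · by_cases hee : e = e'
        · subst hee
          exact h1 h2
        · have hv := G.mem_vert_of_mem_range hee hx hx'
          exact h1 ((hR e he x hx hv).1 ((hR e' he' x hx' hv).2 h2))
  have hbZ : b ∈ Z Rᶜ := Or.inl ⟨hb, fun ⟨Y, h⟩ => hab Y h⟩
  have haZ : a ∉ Z Rᶜ := fun h => hdisj a ⟨h, Or.inl ⟨ha, _, Chain.nil⟩⟩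
  refine ⟨(Z Rᶜ).piecewise (fun x => g x + c) g, ?_, fun x hx => ?_,
    piecewise_eq_of_notMem _ _ _ haZ, piecewise_eq_of_mem _ _ _ hbZ⟩
  · rw [hsub] at hg ⊢
    exact continuousOn_piecewise_union (hZ _) (hZ _)
      ((hg.mono subset_union_left).add continuousOn_const) (hg.mono subset_union_right)
      fun x hx => (hdisj x hx).elim
  · by_cases h : x ∈ Z Rᶜ
    · rw [piecewise_eq_of_mem _ _ _ h, exp_add, hc, mul_one, eg x hx]
    · rw [piecewise_eq_of_notMem _ _ _ h, eg x hx]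

/-- Edges are added one at a time. The logarithm along a new edge, started at the known value at one
end, may miss the known value at the other end by a multiple of `2πi`. If no chain joins the ends,
the old logarithm can be shifted to fit; otherwise a misfit shows that the simple closed curve
formed by a chain and the edge carries no logarithm. -/
theorem hasLog_sub_or_exists_curve [Finite ι] {f : S2 → ℂ} (hf : ContinuousOn f G.carrier)
    (h0 : ∀ x ∈ G.carrier, f x ≠ 0) (S : Set ι) :
    HasLog f (G.sub S) ∨
      ∃ T ⊆ S, IsSimpleClosedCurve (⋃ e ∈ T, range (G.arc e)) ∧
        ¬ HasLog f (⋃ e ∈ T, range (G.arc e)) := by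
  induction S, S.toFinite using Set.Finite.induction_on with
  | empty =>
    refine Or.inl ⟨fun x => log (f x), ?_, fun x hx => exp_log (h0 x ?_)⟩
    · have : G.sub ∅ = G.vert := by simp [sub]
      rw [this]
      exact G.vert.finite_toSet.continuousOn _
    · exact vert_subset_carrier (by simpa [sub] using hx)
  | @insert e S he _ ih =>
    rcases ih with ⟨g, hg, eg⟩ | ⟨T, hT, h⟩
    swap
    · exact Or.inr ⟨T, hT.trans (subset_insert _ _), h⟩
    set a := G.arc e 0
    set b := G.arc e 1
    have hav : a ∈ G.vert := G.arc_zero_mem e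
    have hbv : b ∈ G.vert := G.arc_one_mem e
    have haS : a ∈ G.sub S := Or.inl hav
    have hbS : b ∈ G.sub S := Or.inl hbv
    obtain ⟨h, hh, eh, hh0⟩ := exists_log_arc hf h0 e (eg a haS)
    have hXe : ∀ t, G.arc e t ∈ G.sub S → t = 0 ∨ t = 1 := fun t ht =>
      G.eq_zero_or_one_of_mem_vert (mem_vert_of_mem_sub he (mem_range_self t) ht)
    have hext : ∀ g : S2 → ℂ, ContinuousOn g (G.sub S) → (∀ x ∈ G.sub S, exp (g x) = f x) →
        h 0 = g a → h 1 = g b → HasLog f (G.sub (insert e S)) := by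
      intro g hg eg h0 h1
      obtain ⟨g', hg', eg', -⟩ := exists_log_union_arc (isClosed_sub S) hg eg hh eh hXe h0 h1
      rw [sub_insert]
      exact ⟨g', hg', eg'⟩
    by_cases hY : ∃ Y, G.Chain S a b Y
    · obtain ⟨Y, hY⟩ := hY
      by_cases h1 : h 1 = g b
      · exact Or.inl (hext g hg eg hh0 h1)
      · obtain ⟨T, hT, hYT⟩ := hY.exists_edges
        have hD : (⋃ e' ∈ insert e T, range (G.arc e')) = Y ∪ range (G.arc e) := by
          have haD : {a} ⊆ range (G.arc e) := singleton_subset_iff.2 (mem_range_self 0)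
          rw [hYT, biUnion_insert, union_right_comm, union_eq_right.2 haD]
        have hYS : Y ⊆ G.sub S := by
          rw [hYT]
          exact union_subset_union (singleton_subset_iff.2 hav) (biUnion_subset_biUnion_left hT)
        refine Or.inr ⟨insert e T, insert_subset_insert hT, ?_, ?_⟩
        · rw [hD]
          exact hY.isSimpleClosedCurve hav he (Or.inr ⟨rfl, rfl⟩)
        · rw [hD]
          rintro ⟨k, hk, ek⟩
          -- A logarithm `k` on the curve differs from `g` by a constant on the chain and from `h`
          -- by a constant on the edge, so `g b - g a = h 1 - h 0`; as `h 0 = g a`, the values would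
          -- fit.
          obtain ⟨n, hn⟩ := exists_int_of_exp_eq hY.isPreconnected
            (hk.mono subset_union_left) (hg.mono hYS)
            fun x hx => (ek x (Or.inl hx)).trans (eg x (hYS hx)).symm
          obtain ⟨m, hm⟩ := exists_int_of_exp_eq (isPreconnected_univ (α := unitInterval))
            (hk.comp_continuous (G.arc e).continuous
              fun t => Or.inr (mem_range_self t)).continuousOn hh.continuousOn
            fun t _ => (ek _ (Or.inr (mem_range_self t))).trans (eh t).symm
          have h2 := hn a hY.left_mem
          have h3 := hn b hY.right_mem
          have h4 : k a = h 0 + m * (2 * Real.pi * I) := hm 0 trivial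
          have h5 : k b = h 1 + m * (2 * Real.pi * I) := hm 1 trivial
          exact h1 (by linear_combination h3 - h5 + h4 - h2 + hh0)
    · push Not at hY
      left
      have hc : exp (h 1 - g b) = 1 := by
        rw [exp_sub, eh, eg b hbS]
        exact div_self (h0 _ (vert_subset_carrier hbv))
      obtain ⟨g', hg', eg', h1, h2⟩ := exists_log_shift hg eg hav hbv hY hc
      exact hext g' hg' eg' (by rw [hh0, h1]) (by rw [h2]; ring)

/-- The set `X` may contain mere pieces of edges, but these are no obstruction: an edge not
contained in `X` is cut at an interior point off `X`, where the logarithm may jump. -/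
theorem hasLog_of_hasLog_sub [Finite ι] {f : S2 → ℂ} (hf : ContinuousOn f G.carrier)
    (h0 : ∀ x ∈ G.carrier, f x ≠ 0) {X : Set S2} (hX : IsClosed X) (hXG : X ⊆ G.carrier)
    (h : HasLog f (G.sub {e | range (G.arc e) ⊆ X})) : HasLog f X := by
  classical
  set S : Set ι := {e | range (G.arc e) ⊆ X}
  suffices hF : ∀ F : Set ι, HasLog f (G.sub S ∪ ⋃ e ∈ F, (range (G.arc e) ∩ X)) by
    refine (hF univ).mono fun x hx => ?_
    rcases hXG hx with hv | hx'
    · exact Or.inl (Or.inl hv)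
    · obtain ⟨e, he⟩ := mem_iUnion.1 hx'
      exact Or.inr (mem_iUnion₂.2 ⟨e, trivial, he, hx⟩)
  intro F
  induction F, F.toFinite using Set.Finite.induction_on with
  | empty => simpa using h
  | @insert e F he _ ih =>
    rw [biUnion_insert, union_comm (range _ ∩ X), ← union_assoc]
    set Z := G.sub S ∪ ⋃ e ∈ F, (range (G.arc e) ∩ X)
    have hZ : IsClosed Z := (isClosed_sub S).union
      (F.toFinite.isClosed_biUnion fun e _ => (G.isClosed_arc e).inter hX)
    by_cases heS : e ∈ S
    · refine ih.mono (union_subset subset_rfl fun x hx => Or.inl (Or.inr ?_))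
      exact mem_iUnion₂.2 ⟨e, heS, hx.1⟩
    have hZe : ∀ t, G.arc e t ∈ Z → t = 0 ∨ t = 1 := fun t ht => by
      refine G.eq_zero_or_one_of_mem_vert (e := e) ?_
      rcases ht with ht | ht
      · exact mem_vert_of_mem_sub heS (mem_range_self t) ht
      · refine mem_vert_of_mem_sub he (mem_range_self t) (Or.inr ?_)
        exact iUnion₂_mono (fun e _ => inter_subset_left) ht
    obtain ⟨g, hg, eg⟩ := ih
    have hmem : ∀ t, G.arc e t ∈ G.carrier := fun t => arc_subset_carrier e (mem_range_self t)
    have h0Z : G.arc e 0 ∈ Z := Or.inl (Or.inl (G.arc_zero_mem e))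
    have h1Z : G.arc e 1 ∈ Z := Or.inl (Or.inl (G.arc_one_mem e))
    obtain ⟨h, hh, eh, hh0⟩ := exists_log_arc hf h0 e (eg _ h0Z)
    obtain ⟨t₀, ht₀, ht₀X⟩ : ∃ t₀ ∈ Ioo (0 : unitInterval) 1, G.arc e t₀ ∉ X := by
      by_contra! hc
      refine heS (range_subset_iff.2 fun t => ?_)
      have hcl : IsClosed (G.arc e ⁻¹' X) := hX.preimage (G.arc e).continuous
      have : closure (Ioo (0 : unitInterval) 1) ⊆ G.arc e ⁻¹' X :=
        closure_minimal (fun t ht => hc t ht) hcl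
      rw [closure_Ioo zero_ne_one] at this
      exact this ⟨t.2.1, t.2.2⟩
    let T : Set unitInterval := G.arc e ⁻¹' X ∪ {0, 1}
    have hT : IsClosed T := (hX.preimage (G.arc e).continuous).union (toFinite _).isClosed
    have ht₀T : t₀ ∉ T := by
      rintro (h | h | h)
      · exact ht₀X h
      · exact ht₀.1.ne' h
      · exact ht₀.2.ne h
    let c := g (G.arc e 1) - h 1
    have hc : exp c = 1 := by
      rw [exp_sub, eg _ h1Z, eh, div_self (h0 _ (hmem 1))]
    -- The jump by `c` takes place at `t₀`, which is outside the closed set `T`, so `h'` is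
    -- continuous on `T` while it fits `g` at both ends of the edge.
    let h' : unitInterval → ℂ := (T ∩ Iic t₀).piecewise h fun t => h t + c
    have hh' : ContinuousOn h' T := by
      have := continuousOn_piecewise_union (hT.inter isClosed_Iic) (hT.inter isClosed_Ici)
        (f := h) (g := fun t => h t + c) (A := T ∩ Iic t₀) (B := T ∩ Ici t₀)
        hh.continuousOn (hh.add continuous_const).continuousOn
        (fun t ht => absurd (le_antisymm (mem_Iic.1 ht.1.2) (mem_Ici.1 ht.2.2) ▸ ht.1.1) ht₀T)
      rwa [← inter_union_distrib_left, Iic_union_Ici, inter_univ] at this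
    have h0' : h' 0 = g (G.arc e 0) := by
      rw [← hh0]
      exact piecewise_eq_of_mem _ _ _ ⟨Or.inr (Or.inl rfl), ht₀.1.le⟩
    have h1' : h' 1 = g (G.arc e 1) := by
      have : h' 1 = h 1 + c := piecewise_eq_of_notMem _ _ _ fun h => ht₀.2.not_ge h.2
      rw [this]
      ring
    have eh' : ∀ t, exp (h' t) = f (G.arc e t) := by
      intro t
      by_cases ht : t ∈ T ∩ Iic t₀
      · rw [← eh, show h' t = h t from piecewise_eq_of_mem _ _ _ ht]
      · rw [← eh, show h' t = h t + c from piecewise_eq_of_notMem _ _ _ ht, exp_add, hc, mul_one]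
    have : CompactSpace T := isCompact_iff_compactSpace.1 hT.isCompact
    obtain ⟨g', hg', h2, h3⟩ := exists_glue (T := T) hZ hg (γ := fun t => G.arc e t)
      (h := fun t => h' t) (by fun_prop)
      (continuousOn_iff_continuous_domRestrict.1 hh') (fun s t hst => by
        rcases G.nearlyInjective_arc e s t hst with h | ⟨hs, ht⟩ | ⟨hs, ht⟩
        · rw [h]
        · simp only [hs, ht] at hst ⊢
          rw [h0', h1', hst]
        · simp only [hs, ht] at hst ⊢
          rw [h0', h1', hst])
      (fun t ht => by rcases hZe t ht with h | h <;> rw [h] <;> assumption)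
    have hlog : HasLog f (Z ∪ range fun t : T => G.arc e t) := by
      refine ⟨g', hg', ?_⟩
      rintro x (hx | ⟨t, rfl⟩)
      · rw [h2 x hx, eg x hx]
      · rw [h3, eh']
    refine hlog.mono (union_subset_union_right _ ?_)
    rintro _ ⟨⟨t, rfl⟩, ht⟩
    exact ⟨⟨t, Or.inl ht⟩, rfl⟩

/-- If a function without zeros has no logarithm on a closed part of the graph, it has none on some
simple loop in that part. -/
theorem exists_isSimpleLoop_not_hasLog [Finite ι] {f : S2 → ℂ} (hf : ContinuousOn f G.carrier)
    (h0 : ∀ x ∈ G.carrier, f x ≠ 0) {X : Set S2} (hX : IsClosed X) (hXG : X ⊆ G.carrier)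
    (h : ¬ HasLog f X) : ∃ D ⊆ X, G.IsSimpleLoop D ∧ ¬ HasLog f D := by
  rcases hasLog_sub_or_exists_curve hf h0 {e | range (G.arc e) ⊆ X} with h' | ⟨T, hT, h1, h2⟩
  · exact absurd (hasLog_of_hasLog_sub hf h0 hX hXG h') h
  · exact ⟨⋃ e ∈ T, range (G.arc e), iUnion₂_subset fun e he => hT he, ⟨h1, T, rfl⟩, h2⟩

theorem IsSimpleLoop.subset_carrier {D : Set S2} (h : G.IsSimpleLoop D) : D ⊆ G.carrier := by
  obtain ⟨-, S, rfl⟩ := h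
  exact iUnion₂_subset fun e _ => arc_subset_carrier e

/-- A closed part of the graph that separates two points contains a simple loop that does. -/
theorem exists_isSimpleLoop_side_ne [Finite ι] {X : Set S2} (hX : IsClosed X) (hXG : X ⊆ G.carrier)
    {p q : S2} (hp : p ∉ G.carrier) (hq : q ∉ G.carrier) (h : side X p ≠ side X q) :
    ∃ D ⊆ X, G.IsSimpleLoop D ∧ side D p ≠ side D q := by
  obtain ⟨c⟩ := nonempty_planeChart q
  have hpq : p ≠ q := fun e => h (e ▸ rfl)
  obtain ⟨D, hDX, hD, hDl⟩ := exists_isSimpleLoop_not_hasLog (G := G)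
    (f := fun x => c.coord x - c.coord p)
    ((c.continuousOn_coord.mono fun x hx e => hq (e ▸ hx)).sub continuousOn_const)
    (fun x hx => c.coord_ne (fun e => hq (e ▸ hx)) hpq fun e => hp (e ▸ hx)) hX hXG
    (c.not_hasLog_of_side_ne hX (fun h => hq (hXG h)) (fun h => hp (hXG h)) h)
  refine ⟨D, hDX, hD, fun hs => hDl ?_⟩
  exact c.hasLog_of_side_eq hD.1.isClosed (fun h => hq (hD.subset_carrier h))
    (fun h => hp (hD.subset_carrier h)) hpq hs

end EmbeddedGraph

end Pants

/-! ### Faces: density of their union and finiteness -/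

namespace Pants

open Complex Set Filter Topology

/-- The difference of the values at antipodal points changes sign along a half circle. -/
theorem exists_ne_apply_eq_of_circle {φ : Circle → ℝ} (hφ : Continuous φ) :
    ∃ z w, z ≠ w ∧ φ z = φ w := by
  let u : ℝ → ℝ := fun θ => φ (Circle.exp θ) - φ (-Circle.exp θ)
  have hneg : Continuous fun z : Circle => -z :=
    Continuous.subtype_mk (by fun_prop) _
  have hu : Continuous u := by
    refine (by fun_prop : Continuous fun θ => φ (Circle.exp θ)).sub ?_
    exact hφ.comp (hneg.comp Circle.exp.continuous)
  have h : u Real.pi = -u 0 := by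
    have : Circle.exp Real.pi = -1 := Circle.ext (by simp)
    simp [u, this]
  have h0 : (0 : ℝ) ∈ range u := by
    rcases le_total (u 0) 0 with h' | h'
    · exact mem_range_of_exists_le_of_exists_ge hu ⟨0, h'⟩ ⟨Real.pi, by linarith⟩
    · exact mem_range_of_exists_le_of_exists_ge hu ⟨Real.pi, by linarith⟩ ⟨0, h'⟩
  obtain ⟨θ, hθ⟩ := h0
  refine ⟨Circle.exp θ, -Circle.exp θ, fun e => ?_, sub_eq_zero.1 hθ⟩
  have := congrArg (fun z : Circle => (z : ℂ)) e
  simp only [Circle.coe_neg] at this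
  exact Circle.coe_ne_zero (Circle.exp θ) (self_eq_neg.1 this)

instance : Nontrivial S2 := by
  obtain ⟨N⟩ : Nonempty S2 := inferInstance
  obtain ⟨c⟩ := nonempty_planeChart N
  exact ⟨⟨_, _, c.point_ne 0⟩⟩

namespace EmbeddedGraph

variable {ι : Type*} {G : EmbeddedGraph ι}

/-- If an edge contained a disc, then the inverse of its parametrization would embed a small circle
into the interval. -/
theorem interior_arc_eq_empty (e : ι) : interior (range (G.arc e)) = ∅ := by
  by_contra hne
  have hfin : Dense (({G.arc e 0, G.arc e 1} : Set S2)ᶜ) := by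
    simpa [compl_eq_univ_sdiff] using dense_univ.sdiff_finite (toFinite {G.arc e 0, G.arc e 1})
  obtain ⟨c⟩ := nonempty_planeChart (G.arc e 0)
  -- The ends are removed because on a self-loop the parametrization is not injective there.
  set O := interior (range (G.arc e)) ∩ {G.arc e 0, G.arc e 1}ᶜ
  have hO : IsOpen O := isOpen_interior.inter (toFinite _).isClosed.isOpen_compl
  obtain ⟨x, hx⟩ : O.Nonempty :=
    hfin.inter_open_nonempty _ isOpen_interior (nonempty_iff_ne_empty.2 hne)
  have hxc : c.coord x ∈ c.point ⁻¹' O := by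
    rw [mem_preimage, c.point_coord x fun h => hx.2 (Or.inl h)]
    exact hx
  obtain ⟨ε, hε, hball⟩ := Metric.isOpen_iff.1 (hO.preimage c.continuous_point) _ hxc
  let ψ : Circle → S2 := fun w => c.point (c.coord x + (ε / 2 : ℝ) * w)
  have hψ : Continuous ψ := c.continuous_point.comp (by fun_prop)
  have hψi : Function.Injective ψ := by
    intro z w h
    have := congrArg c.coord h
    simp only [ψ, c.coord_point, add_right_inj, mul_eq_mul_left_iff] at this
    refine Subtype.ext (this.resolve_right ?_)
    exact_mod_cast (half_pos hε).ne'
  have hψO : ∀ w, ψ w ∈ O := fun w => hball (by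
    simp only [Metric.mem_ball, dist_self_add_left, norm_mul, norm_real, Circle.norm_coe, mul_one,
      Real.norm_eq_abs, abs_of_pos (half_pos hε)]
    linarith)
  let T : Set unitInterval := G.arc e ⁻¹' range ψ
  have hT : IsClosed T := (isCompact_range hψ).isClosed.preimage (G.arc e).continuous
  have : CompactSpace T := isCompact_iff_compactSpace.1 hT.isCompact
  have hinv : ∀ t ∈ T, Function.invFun (G.arc e) (G.arc e t) = t := by
    rintro t ⟨w, hw⟩
    have htO : G.arc e t ∈ O := hw ▸ hψO w
    rcases G.nearlyInjective_arc e _ _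
      (Function.invFun_eq (f := G.arc e) ⟨t, rfl⟩) with h | ⟨-, rfl⟩ | ⟨-, rfl⟩
    · exact h
    · exact absurd (Or.inr rfl) htO.2
    · exact absurd (Or.inl rfl) htO.2
  have hcont : ContinuousOn (Function.invFun (G.arc e)) (range fun t : T => G.arc e t) :=
    continuousOn_range_of_comp (by fun_prop) (by
      have : (fun t : T => Function.invFun (G.arc e) (G.arc e t)) = fun t : T => (t : unitInterval) :=
        funext fun t => hinv t t.2
      rw [this]
      exact continuous_subtype_val)
  have hψr : ∀ w, ψ w ∈ range (G.arc e) := fun w => interior_subset (hψO w).1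
  obtain ⟨z, w, hzw, h⟩ := exists_ne_apply_eq_of_circle
    (φ := fun w => ((Function.invFun (G.arc e) (ψ w) : unitInterval) : ℝ))
    (continuous_subtype_val.comp (hcont.comp_continuous hψ fun w => by
      obtain ⟨t, ht⟩ := hψr w
      exact ⟨⟨t, w, ht.symm⟩, ht⟩))
  refine hzw (hψi ?_)
  rw [← Function.invFun_eq (hψr z), ← Function.invFun_eq (hψr w)]
  exact congrArg _ (Subtype.ext h)

theorem dense_compl_carrier [Finite ι] : Dense (G.carrierᶜ) := by
  rw [carrier, compl_union, compl_iUnion]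
  refine Dense.inter_of_isOpen_left ?_ (dense_iInter_of_isOpen
    (fun e => (G.isClosed_arc e).isOpen_compl)
    fun e => interior_eq_empty_iff_dense_compl.1 (G.interior_arc_eq_empty e))
    G.vert.finite_toSet.isClosed.isOpen_compl
  simpa [compl_eq_univ_sdiff] using dense_univ.sdiff_finite G.vert.finite_toSet

theorem eq_side_of_mem {F : Set S2} (hF : F ∈ G.faces) {x : S2} (hx : x ∈ F) :
    F = side G.carrier x := by
  obtain ⟨y, hy, rfl⟩ := hF
  exact side_eq_of_mem hx

theorem faces_subset {F : Set S2} (hF : F ∈ G.faces) : F ⊆ G.carrierᶜ := by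
  obtain ⟨y, hy, rfl⟩ := hF
  exact side_subset

theorem faces_nonempty {F : Set S2} (hF : F ∈ G.faces) : F.Nonempty := by
  obtain ⟨y, hy, rfl⟩ := hF
  exact ⟨y, mem_side hy⟩

theorem isPreconnected_face {F : Set S2} (hF : F ∈ G.faces) : IsPreconnected F := by
  obtain ⟨y, hy, rfl⟩ := hF
  exact isPreconnected_side

theorem isOpen_face [Finite ι] {F : Set S2} (hF : F ∈ G.faces) : IsOpen F := by
  obtain ⟨y, hy, rfl⟩ := hF
  exact isOpen_side isClosed_carrier

theorem side_mem_faces {x : S2} (hx : x ∉ G.carrier) : side G.carrier x ∈ G.faces := ⟨x, hx, rfl⟩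

/-- Logarithms along the edges that fit at the vertices give a logarithm on the graph. -/
theorem hasLog_carrier [Finite ι] {f g₀ : S2 → ℂ} (eg : ∀ v ∈ G.vert, exp (g₀ v) = f v)
    (h : ∀ e, ∃ h : unitInterval → ℂ, Continuous h ∧ (∀ t, exp (h t) = f (G.arc e t)) ∧
      h 0 = g₀ (G.arc e 0) ∧ h 1 = g₀ (G.arc e 1)) : HasLog f G.carrier := by
  suffices hS : ∀ S : Set ι, ∃ g, ContinuousOn g (G.sub S) ∧ (∀ x ∈ G.sub S, exp (g x) = f x) ∧
      ∀ v ∈ G.vert, g v = g₀ v by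
    obtain ⟨g, hg, eg, -⟩ := hS univ
    exact carrier_eq_sub ▸ ⟨g, hg, eg⟩
  intro S
  induction S, S.toFinite using Set.Finite.induction_on with
  | empty =>
    have : G.sub ∅ = G.vert := by simp [sub]
    rw [this]
    exact ⟨g₀, G.vert.finite_toSet.continuousOn _, eg, fun _ _ => rfl⟩
  | @insert e S he _ ih =>
    obtain ⟨g, hg, eg, hv⟩ := ih
    obtain ⟨k, hk, ek, h0, h1⟩ := h e
    obtain ⟨g', hg', eg', h'⟩ := exists_log_union_arc (isClosed_sub S) hg eg hk ek
      (fun t ht => G.eq_zero_or_one_of_mem_vert (mem_vert_of_mem_sub he (mem_range_self t) ht))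
      (by rw [h0, hv _ (G.arc_zero_mem e)]) (by rw [h1, hv _ (G.arc_one_mem e)])
    rw [sub_insert]
    exact ⟨g', hg', eg', fun v hv' => (h' v (Or.inl hv')).trans (hv v hv')⟩

variable (G) in
-- Each face other than that of `N` gives an integer vector on the edges: the amount by which the
-- logarithm of the coordinate centred in the face, continued along an edge, misses the principal
-- logarithm at the final end. A linear relation between these vectors would give a logarithm on `G`
-- of the corresponding product of powers, so by `eq_zero_of_hasLog_prod` they are independent in a
-- module of finite rank.
theorem finite_faces [Finite ι] : G.faces.Finite := by
  classical
  rcases G.faces.eq_empty_or_nonempty with h | ⟨_, N, hN, rfl⟩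
  · rw [h]
    exact finite_empty
  obtain ⟨c⟩ := nonempty_planeChart N
  let κ := {F : Set S2 // F ∈ G.faces ∧ F ≠ side G.carrier N}
  suffices Finite κ by
    refine (finite_coe_iff.1 this).union (finite_singleton (side G.carrier N)) |>.subset ?_
    intro F hF
    by_cases h : F = side G.carrier N
    · exact Or.inr h
    · exact Or.inl ⟨hF, h⟩
  choose p hp hpF using fun F : κ => F.2.1
  have hpN : ∀ F, p F ≠ N := fun F e => F.2.2 ((hpF F).trans (congrArg _ e))
  let f : κ → S2 → ℂ := fun F x => c.coord x - c.coord (p F)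
  have hf : ∀ F, ContinuousOn (f F) G.carrier := fun F =>
    (c.continuousOn_coord.mono fun x hx e => hN (e ▸ hx)).sub continuousOn_const
  have hf0 : ∀ F, ∀ x ∈ G.carrier, f F x ≠ 0 := fun F x hx =>
    c.coord_ne (fun e => hN (e ▸ hx)) (hpN F) fun e => hp F (e ▸ hx)
  have hlog : ∀ F, ∀ v ∈ G.vert, exp (log (f F v)) = f F v := fun F v hv =>
    exp_log (hf0 F v (vert_subset_carrier hv))
  choose h hh eh h0 using fun (F : κ) (e : ι) =>
    exists_log_arc (hf F) (hf0 F) e (hlog F _ (G.arc_zero_mem e))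
  choose n hn using fun (F : κ) (e : ι) => exp_eq_exp_iff_exists_int.1
    ((eh F e 1).trans (hlog F _ (G.arc_one_mem e)).symm)
  refine LinearIndependent.finite (R := ℤ) (M := ι → ℤ) (f := n) (linearIndependent_iff'.2 ?_)
  intro s a ha k hk
  have hprod : ∀ (x : S2) (w : κ → ℂ), (∀ F, exp (w F) = f F x) →
      exp (∑ F ∈ s, a F * w F) = ∏ F ∈ s, f F x ^ a F := by
    intro x w hw
    rw [exp_sum]
    exact Finset.prod_congr rfl fun F _ => by rw [exp_int_mul, hw]
  refine c.eq_zero_of_hasLog_prod isClosed_carrier hN s p a hk (fun j _ => hpN j) (hp k)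
    (fun e => k.2.2 ((hpF k).trans e)) (fun j _ hjk hj => ?_)
    (hasLog_carrier (g₀ := fun v => ∑ F ∈ s, a F * log (f F v)) ?_ fun e =>
      ⟨fun t => ∑ F ∈ s, a F * h F e t, by fun_prop, fun t => ?_, ?_, ?_⟩)
  · refine hjk (Subtype.ext ?_)
    rw [hpF j, hpF k]
    exact (side_eq_of_mem (hj.resolve_right (hp j))).symm
  · exact fun v hv => hprod v _ fun F => hlog F v hv
  · exact hprod _ _ fun F => eh F e t
  · exact Finset.sum_congr rfl fun F _ => by rw [h0]
  · have := congrFun ha e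
    simp only [Finset.sum_apply, Pi.smul_apply, smul_eq_mul, Pi.zero_apply] at this
    have h2 : (∑ F ∈ s, a F * n F e : ℂ) = 0 := by exact_mod_cast this
    simp only [hn, mul_add, Finset.sum_add_distrib]
    rw [add_eq_left]
    simp only [← mul_assoc]
    rw [← Finset.sum_mul, ← Finset.sum_mul, ← Finset.sum_mul, h2]
    simp

instance [Finite ι] : Finite G.faces := G.finite_faces

end EmbeddedGraph

end Pants

/-! ### Loops bounding sets of faces, and the face distance -/

namespace Pants

open Set Filter Topology

theorem subset_of_disjoint_frontier {S U : Set S2} (hS : IsPreconnected S) (hU : IsOpen U)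
    (h : Disjoint S (frontier U)) (hne : (S ∩ U).Nonempty) : S ⊆ U := by
  refine IsPreconnected.subset_left_of_subset_union hU isClosed_closure.isOpen_compl
    (disjoint_compl_right_iff_subset.2 subset_closure) (fun x hx => ?_) hne hS
  by_cases hxc : x ∈ closure U
  · exact Or.inl (by_contra fun hxU => disjoint_left.1 h hx ⟨hxc, by rwa [hU.interior_eq]⟩)
  · exact Or.inr hxc

theorem side_eq_of_mem_closure {C F : Set S2} (hC : IsClosed C) (hF : IsPreconnected F)
    (hFC : Disjoint F C) {x v : S2} (hx : x ∈ F) (hv : v ∉ C) (hvF : v ∈ closure F) :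
    side C x = side C v := by
  obtain ⟨y, hy, hyF⟩ := mem_closure_iff.1 hvF _ (isOpen_side hC) (mem_side hv)
  rw [side_eq_of_mem (subset_side hF hx hFC hyF), ← side_eq_of_mem hy]

theorem exists_mem_closure_side {C : Set S2} (hC : IsClosed C) {x y : S2} (hx : x ∉ C)
    (hxy : y ∉ side C x) : ∃ z ∈ C, z ∈ closure (side C x) := by
  by_contra! h
  have hcl : IsClosed (side C x) := isClosed_of_closure_subset fun z hz =>
    (closure_side_subset hC hz).resolve_right fun hzC => h z hzC hz
  have := IsClopen.eq_univ ⟨hcl, isOpen_side hC⟩ ⟨x, mem_side hx⟩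
  exact hxy (this ▸ mem_univ y)

theorem IsOfType.side_ne {P : Fin 3 → S2} {i j : Fin 3} {C : Set S2} (h : IsOfType P i C)
    (hj : j ≠ i) : side C (P i) ≠ side C (P j) := by
  have : ∀ i j : Fin 3, j ≠ i → j = i + 1 ∨ j = i + 2 := by decide
  rcases this i j hj with rfl | rfl
  · exact h.2.2
  · exact h.2.1 ▸ h.2.2

theorem IsOfType.unique {P : Fin 3 → S2} {i j : Fin 3} {C : Set S2} (h : IsOfType P i C)
    (h' : IsOfType P j C) : i = j := by
  have : ∀ i j : Fin 3, i ≠ j → j = i + 1 ∨ j = i + 2 := by decide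
  by_contra hij
  rcases this i j hij with rfl | rfl
  · exact h'.side_ne (fun e => by simp at e) h.2.1
  · exact h'.side_ne (fun e => by simp at e) h.2.1.symm

namespace EmbeddedGraph

variable {ι : Type*} {G : EmbeddedGraph ι}

theorem IsSimpleLoop.exists_mem_vert {D : Set S2} (h : G.IsSimpleLoop D) : ∃ v ∈ G.vert, v ∈ D := by
  obtain ⟨⟨f, -, hf⟩, S, rfl⟩ := h
  obtain ⟨e, he, -⟩ := mem_iUnion₂.1 (hf ▸ mem_range_self 1 : f 1 ∈ ⋃ e ∈ S, range (G.arc e))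
  exact ⟨_, G.arc_zero_mem e, mem_iUnion₂.2 ⟨e, he, mem_range_self 0⟩⟩

theorem IsSimpleLoop.disjoint {C D : Set S2} (hC : G.IsSimpleLoop C) (hD : G.IsSimpleLoop D)
    (h : ∀ v ∈ G.vert, ¬ (v ∈ C ∧ v ∈ D)) : Disjoint C D := by
  obtain ⟨-, S, rfl⟩ := hC
  obtain ⟨-, T, rfl⟩ := hD
  refine disjoint_left.2 fun x hx hx' => ?_
  obtain ⟨e, he, hxe⟩ := mem_iUnion₂.1 hx
  obtain ⟨e', he', hxe'⟩ := mem_iUnion₂.1 hx'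
  by_cases hee : e = e'
  · subst hee
    exact h _ (G.arc_zero_mem e) ⟨mem_iUnion₂.2 ⟨e, he, mem_range_self 0⟩,
      mem_iUnion₂.2 ⟨e, he', mem_range_self 0⟩⟩
  · exact h x (G.mem_vert_of_mem_range hee hxe hxe') ⟨hx, hx'⟩

theorem IsSimpleLoop.disjoint_face {D : Set S2} (h : G.IsSimpleLoop D) (F : G.faces) :
    Disjoint (F : Set S2) D :=
  disjoint_left.2 fun _ hx hxD => faces_subset F.2 hx (h.subset_carrier hxD)

variable (G) in
theorem finite_setOf_isSimpleLoop [Finite ι] : {D | G.IsSimpleLoop D}.Finite :=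
  (finite_range fun S : Set ι => ⋃ e ∈ S, range (G.arc e)).subset
    fun _ hD => let ⟨S, hS⟩ := hD.2; ⟨S, hS.symm⟩

theorem adj_exists_vert {F F' : G.faces} (h : G.faceGraph.Adj F F') :
    ∃ v ∈ G.vert, v ∈ closure (F : Set S2) ∧ v ∈ closure (F' : Set S2) := by
  rcases h.2 with ⟨e, h, h'⟩ | h
  · exact ⟨_, G.arc_zero_mem e, h (mem_range_self 0), h' (mem_range_self 0)⟩
  · exact h

theorem eq_or_adj {F F' : G.faces} {v : S2} (hv : v ∈ G.vert) (h : v ∈ closure (F : Set S2))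
    (h' : v ∈ closure (F' : Set S2)) : F = F' ∨ G.faceGraph.Adj F F' :=
  (eq_or_ne F F').imp_right fun hne => ⟨hne, Or.inr ⟨v, hv, h, h'⟩⟩

theorem face_eq_of_mem {F F' : G.faces} {x : S2} (h : x ∈ (F : Set S2)) (h' : x ∈ (F' : Set S2)) :
    F = F' :=
  Subtype.ext ((eq_side_of_mem F.2 h).trans (eq_side_of_mem F'.2 h').symm)

/-- A set of faces is separated from a point outside of its closure by a simple loop made up of
points that belong both to the closure of a face in the set and to that of a face not in the set. -/
theorem exists_isSimpleLoop_frontier [Finite ι] (𝒜 : Set G.faces) {A : G.faces} (hA : A ∈ 𝒜) {p q : S2}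
    (hp : p ∈ (A : Set S2)) (hq : q ∉ G.carrier) (hqA : q ∉ closure (⋃ B ∈ 𝒜, (B : Set S2))) :
    ∃ D, G.IsSimpleLoop D ∧ side D p ≠ side D q ∧
      Disjoint (side (closure (⋃ B ∈ 𝒜, (B : Set S2))) q) D ∧
      ∀ v ∈ D, (∃ F ∈ 𝒜, v ∈ closure (F : Set S2)) ∧ ∃ F ∉ 𝒜, v ∈ closure (F : Set S2) := by
  set K := closure (⋃ B ∈ 𝒜, (B : Set S2)) with hK
  have hKc : IsClosed K := isClosed_closure
  have hU : IsOpen (side K q) := isOpen_side hKc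
  have hAK : ∀ B ∈ 𝒜, (B : Set S2) ⊆ K := fun B hB =>
    (subset_biUnion_of_mem (u := fun B : G.faces => (B : Set S2)) hB).trans subset_closure
  have hfr : frontier (side K q) ⊆ K := fun x hx =>
    (closure_side_subset hKc hx.1).resolve_left (by rw [← hU.interior_eq]; exact hx.2)
  -- A face containing a frontier point would meet both a face in `𝒜`, hence belong to `𝒜` and lie
  -- in `K`, and the complement of `K`.
  have hfrG : frontier (side K q) ⊆ G.carrier := by
    intro x hx
    by_contra hxG
    let F : G.faces := ⟨side G.carrier x, side_mem_faces hxG⟩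
    have hFn : IsOpen (F : Set S2) := isOpen_face F.2
    have hxF : x ∈ (F : Set S2) := mem_side hxG
    obtain ⟨y, hyF, hy⟩ := mem_closure_iff.1 (hfr hx) _ hFn hxF
    obtain ⟨B, hB, hyB⟩ := mem_iUnion₂.1 hy
    obtain ⟨z, hzF, hz⟩ := mem_closure_iff.1 hx.1 _ hFn hxF
    rw [← face_eq_of_mem hyF hyB] at hB
    exact side_subset hz (hAK F hB hzF)
  have hpG : p ∉ G.carrier := faces_subset A.2 hp
  have hsep : side (frontier (side K q)) p ≠ side (frontier (side K q)) q := by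
    intro h
    have hqfr : q ∉ frontier (side K q) := fun h => hq (hfrG h)
    have hsub : side (frontier (side K q)) q ⊆ side K q :=
      subset_of_disjoint_frontier isPreconnected_side hU
        (disjoint_left.2 fun _ h => side_subset h) ⟨q, mem_side hqfr, mem_side hqA⟩
    exact side_subset (hsub (h ▸ mem_side fun h => hpG (hfrG h))) (hAK A hA hp)
  obtain ⟨D, hDX, hD, hDs⟩ := exists_isSimpleLoop_side_ne isClosed_frontier hfrG hpG hq hsep
  refine ⟨D, hD, hDs, ?_, fun v hv => ⟨?_, ?_⟩⟩
  · exact disjoint_left.2 fun x hx hxD => side_subset hx (hfr (hDX hxD))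
  · have := hfr (hDX hv)
    rw [hK, 𝒜.toFinite.closure_biUnion] at this
    obtain ⟨F, hF, hvF⟩ := mem_iUnion₂.1 this
    exact ⟨F, hF, hvF⟩
  · have hsub : side K q ∩ G.carrierᶜ ⊆ ⋃ B ∈ 𝒜ᶜ, (B : Set S2) := by
      rintro x ⟨hx, hxG⟩
      refine mem_iUnion₂.2 ⟨⟨side G.carrier x, side_mem_faces hxG⟩, fun h => ?_, mem_side hxG⟩
      exact side_subset hx (hAK _ h (mem_side hxG))
    have hvc := closure_mono hsub
      (closure_minimal (dense_compl_carrier.open_subset_closure_inter hU) isClosed_closure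
        (hDX hv).1)
    rw [𝒜ᶜ.toFinite.closure_biUnion] at hvc
    obtain ⟨F, hF, hvF⟩ := mem_iUnion₂.1 hvc
    exact ⟨F, hF, hvF⟩

theorem disjoint_closure_of_disjoint {𝒜 : Set G.faces} {O : Set S2} (hO : IsOpen O)
    (h : ∀ B ∈ 𝒜, Disjoint O (B : Set S2)) : Disjoint O (closure (⋃ B ∈ 𝒜, (B : Set S2))) :=
  (disjoint_iUnion₂_right.2 h).closure_right hO

/-- Otherwise a loop bounding the faces reachable from `F` would have a vertex at both a reachable
and an unreachable face, but faces with a common vertex are adjacent. -/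
theorem preconnected_faceGraph [Finite ι] : G.faceGraph.Preconnected := by
  intro F F'
  by_contra hne
  obtain ⟨p, hp⟩ := faces_nonempty F.2
  obtain ⟨q, hq⟩ := faces_nonempty F'.2
  obtain ⟨D, hD, -, -, h⟩ := exists_isSimpleLoop_frontier {A | G.faceGraph.Reachable F A}
    (SimpleGraph.Reachable.refl F) hp (faces_subset F'.2 hq) fun hqc => by
      refine disjoint_left.1 (disjoint_closure_of_disjoint (isOpen_face F'.2) fun B hB => ?_) hq hqc
      exact disjoint_left.2 fun x hx hxB => hne ((face_eq_of_mem hx hxB) ▸ hB)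
  obtain ⟨v, hv, hvD⟩ := hD.exists_mem_vert
  obtain ⟨⟨A, hA, hvA⟩, B, hB, hvB⟩ := h v hvD
  rcases eq_or_adj hv hvA hvB with rfl | hAB
  · exact hB hA
  · exact hB (hA.trans hAB.reachable)

/-- Disjoint loops that separate two faces are not more than the steps of a face path. -/
theorem encard_le_length {F F' : G.faces} (w : G.faceGraph.Walk F F') :
    ∀ L : Set (Set S2), (∀ C ∈ L, G.IsSimpleLoop C) → G.VertexDisjoint L →
      (∀ C ∈ L, ∀ x ∈ (F : Set S2), ∀ y ∈ (F' : Set S2), side C x ≠ side C y) →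
      L.encard ≤ w.length := by
  induction w with
  | @nil F =>
    intro L _ _ h
    obtain ⟨x, hx⟩ := faces_nonempty F.2
    rw [eq_empty_of_forall_notMem fun C hC => h C hC x hx x hx rfl]
    simp
  | @cons F F₁ F' hadj w ih =>
    intro L hL hdis h
    obtain ⟨v, hv, hvF, hvF₁⟩ := adj_exists_vert hadj
    -- Loops that avoid `v` have `F` and `F₁` on the same side, so they still separate `F₁` from
    -- `F'`; by disjointness at most one loop is lost.
    have h1 := ih {C ∈ L | v ∉ C} (fun C hC => hL C hC.1) (hdis.mono (sep_subset _ _)) (by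
      intro C hC x hx y hy
      have hcl := (hL C hC.1).1.isClosed
      obtain ⟨z, hz⟩ := faces_nonempty F.2
      rw [side_eq_of_mem_closure hcl (isPreconnected_face F₁.2) ((hL C hC.1).disjoint_face F₁) hx
        hC.2 hvF₁, ← side_eq_of_mem_closure hcl (isPreconnected_face F.2)
        ((hL C hC.1).disjoint_face F) hz hC.2 hvF]
      exact h C hC.1 z hz y hy)
    have h2 : {C ∈ L | v ∈ C}.encard ≤ 1 := encard_le_one_iff.2 fun C C' hC hC' => by
      by_contra hne
      exact hdis hC.1 hC'.1 hne v hv ⟨hC.2, hC'.2⟩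
    calc L.encard ≤ ({C ∈ L | v ∉ C} ∪ {C ∈ L | v ∈ C}).encard :=
          encard_le_encard fun C hC => by by_cases h : v ∈ C <;> simp [hC, h]
      _ ≤ w.length + 1 := (encard_union_le _ _).trans (add_le_add h1 h2)
      _ = _ := by simp

theorem encard_le_dist [Finite ι] {F F' : G.faces} {L : Set (Set S2)} (hL : ∀ C ∈ L, G.IsSimpleLoop C)
    (hdis : G.VertexDisjoint L)
    (h : ∀ C ∈ L, ∀ x ∈ (F : Set S2), ∀ y ∈ (F' : Set S2), side C x ≠ side C y) :
    L.encard ≤ G.faceGraph.dist F F' := by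
  obtain ⟨w, hw⟩ := (preconnected_faceGraph F F').exists_walk_length_eq_dist
  exact hw ▸ encard_le_length w L hL hdis h

/-! ### Level loops and the lamination space -/

variable {P : Fin 3 → S2}

theorem isGreatest_maxLoops [Finite ι] (i : Fin 3) : IsGreatest (G.loopCounts P i) (G.maxLoops P i) := by
  have hb : BddAbove (G.loopCounts P i) := by
    refine ⟨{D | G.IsSimpleLoop D}.ncard, ?_⟩
    rintro n ⟨L, hL, -, hn⟩
    have := encard_le_encard (show L ⊆ {D | G.IsSimpleLoop D} from fun C hC => (hL C hC).1)
    rw [hn, ← G.finite_setOf_isSimpleLoop.cast_ncard_eq] at this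
    exact_mod_cast this
  exact ⟨Nat.sSup_mem ⟨0, ∅, by simp, by simp [VertexDisjoint], by simp⟩ hb,
    fun n hn => le_csSup hb hn⟩

theorem side_eq_of_mem_markedFace (hG : G.IsSigmaGraph P) {D : Set S2} (hD : G.IsSimpleLoop D)
    {i : Fin 3} {x : S2} (hx : x ∈ (hG.markedFace i : Set S2)) : side D x = side D (P i) := by
  refine (side_eq_of_mem (subset_side isPreconnected_side (mem_side (hG.notMem_carrier i)) ?_ hx)).symm
  exact hD.disjoint_face (hG.markedFace i)

/-- Among disjoint loops of type `i` there is an outermost one. -/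
theorem exists_outermost [Finite ι] {i : Fin 3} {L : Set (Set S2)} (hne : L.Nonempty)
    (hL : ∀ C ∈ L, G.IsSimpleLoop C ∧ IsOfType P i C) (hdis : G.VertexDisjoint L) :
    ∃ C ∈ L, ∀ C' ∈ L, Disjoint (side C (P (i + 1))) C' := by
  have hfin : L.Finite := G.finite_setOf_isSimpleLoop.subset fun C hC => (hL C hC).1
  -- Outermost means that the side containing `P (i + 1)` is minimal. If `C'` meets this side of
  -- `C`, then it lies in it, `C` lies on the inner side of `C'`, and the outer side of `C'` is
  -- contained in that of `C`, against minimality.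
  obtain ⟨C, hC, hmin⟩ := hfin.exists_minimalFor (fun C => side C (P (i + 1))) L hne
  refine ⟨C, hC, fun C' hC' => ?_⟩
  by_cases hCC' : C = C'
  · subst hCC'
    exact disjoint_left.2 fun x hx => side_subset hx
  by_contra hmeet
  obtain ⟨x, hx, hxC'⟩ := not_disjoint_iff.1 hmeet
  obtain ⟨hl, ht⟩ := hL C hC
  obtain ⟨hl', ht'⟩ := hL C' hC'
  have hd : Disjoint C C' := hl.disjoint hl' (hdis hC hC' hCC')
  have hsub : C' ⊆ side C (P (i + 1)) := by
    rw [side_eq_of_mem hx]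
    exact subset_side hl'.1.isPreconnected hxC' hd.symm
  have hnot : P (i + 1) ∉ side C (P i) := fun h => ht.2.2 (side_eq_of_mem h)
  -- One point of `C` adherent to the inner side suffices to place the whole connected curve `C` on
  -- the inner side of `C'`.
  obtain ⟨y, hyC, hy⟩ := exists_mem_closure_side hl.1.isClosed (ht.1 i) hnot
  have hin : Disjoint (side C (P i)) C' :=
    (disjoint_side ht.2.2).mono_right hsub
  have hyin : side C' (P i) = side C' y := side_eq_of_mem_closure hl'.1.isClosed
    isPreconnected_side hin (mem_side (ht.1 i)) (disjoint_left.1 hd hyC) hy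
  have hCin : C ⊆ side C' (P i) := hyin ▸ subset_side hl.1.isPreconnected hyC hd
  have hout : side C' (P (i + 1)) ⊆ side C (P (i + 1)) :=
    subset_side isPreconnected_side (mem_side (ht'.1 _))
      ((disjoint_side ht'.2.2).symm.mono_right hCin)
  exact side_subset (hmin hC' hout (hsub hxC')) hxC'

/-- For `k` less than the maximal number of disjoint loops of type `i`, some loop of type `i` has all
its points between faces at distance at most `k` and faces at larger distance from the marked
face. -/
theorem exists_levelLoop [Finite ι] (hG : G.IsSigmaGraph P) {i : Fin 3} {k : ℕ} (hk : k < G.maxLoops P i) :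
    ∃ D, G.IsSimpleLoop D ∧ IsOfType P i D ∧ ∀ v ∈ D,
      (∃ F, G.faceGraph.dist (hG.markedFace i) F ≤ k ∧ v ∈ closure (F : Set S2)) ∧
      ∃ F, k < G.faceGraph.dist (hG.markedFace i) F ∧ v ∈ closure (F : Set S2) := by
  obtain ⟨L, hL, hdis, hLM⟩ := (isGreatest_maxLoops (G := G) (P := P) i).1
  have hLne : L.Nonempty := encard_ne_zero.1 (by rw [hLM]; exact_mod_cast (by omega))
  obtain ⟨C, hC, hout⟩ := exists_outermost hLne hL hdis
  obtain ⟨hCl, hCt⟩ := hL C hC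
  set Q := P (i + 1)
  have hCQ : Q ∈ side C Q := mem_side (hCt.1 _)
  -- All loops of the maximal family separate a face beyond `C` from the marked face, so its
  -- distance is at least `M_i > k`.
  have hOut : Disjoint (side C Q)
      (closure (⋃ B ∈ {B | G.faceGraph.dist (hG.markedFace i) B ≤ k}, (B : Set S2))) := by
    refine disjoint_closure_of_disjoint (isOpen_side hCl.1.isClosed) fun B hB => ?_
    refine disjoint_left.2 fun y hy hyB => ?_
    have hle : L.encard ≤ G.faceGraph.dist (hG.markedFace i) B := by
      refine encard_le_dist (fun C hC => (hL C hC).1) hdis fun C' hC' x hx z hz => ?_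
      obtain ⟨hl', ht'⟩ := hL C' hC'
      have hz' : z ∈ side C Q := by
        rw [side_eq_of_mem hy]
        exact subset_side (isPreconnected_face B.2) hyB (hCl.disjoint_face B) hz
      rw [side_eq_of_mem_markedFace hG hl' hx,
        ← side_eq_of_mem (subset_side isPreconnected_side hCQ (hout C' hC') hz')]
      exact ht'.2.2
    rw [hLM] at hle
    have : G.maxLoops P i ≤ G.faceGraph.dist (hG.markedFace i) B := by exact_mod_cast hle
    have hB' : G.faceGraph.dist (hG.markedFace i) B ≤ k := hB
    omega
  obtain ⟨D, hD, hDs, hDU, hDv⟩ := exists_isSimpleLoop_frontier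
    {B | G.faceGraph.dist (hG.markedFace i) B ≤ k} (A := hG.markedFace i) (by simp)
    (mem_side (hG.notMem_carrier i)) (hG.notMem_carrier (i + 1)) (disjoint_left.1 hOut hCQ)
  refine ⟨D, hD, ⟨fun j hj => hG.notMem_carrier j (hD.subset_carrier hj), ?_, hDs⟩, fun v hv => ?_⟩
  -- `P (i + 2)` lies beyond `C` together with `P (i + 1)`, and `D` does not enter that side.
  · have h2 : P (i + 2) ∈ side C Q := (side_eq_iff (hCt.1 _)).1 hCt.2.1
    exact side_eq_of_mem (subset_side isPreconnected_side hCQ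
      (hDU.mono_left (subset_side isPreconnected_side hCQ hOut)) h2)
  · obtain ⟨h1, F, hF, hvF⟩ := hDv v hv
    exact ⟨h1, F, not_le.1 hF, hvF⟩

theorem dist_le_add_one [Finite ι] {F A B : G.faces} {v : S2} (hv : v ∈ G.vert)
    (hA : v ∈ closure (A : Set S2)) (hB : v ∈ closure (B : Set S2)) :
    G.faceGraph.dist F B ≤ G.faceGraph.dist F A + 1 := by
  have : Nonempty G.faces := ⟨F⟩
  have hc : G.faceGraph.Connected := ⟨preconnected_faceGraph⟩
  rcases eq_or_adj hv hA hB with rfl | h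
  · omega
  · have := hc.dist_triangle (u := F) (v := A) (w := B)
    rwa [SimpleGraph.dist_eq_one_iff_adj.2 h] at this

theorem laminationSpace_subset [Finite ι] (hG : G.IsSigmaGraph P) :
    G.laminationSpace P ⊆ latticePolytope (G.maxLoops P) hG.markedDist := by
  rintro m ⟨L, ⟨hL, hdis⟩, hm⟩ i
  refine ⟨(isGreatest_maxLoops i).2 ⟨{C ∈ L | IsOfType P i C}, fun C hC => ⟨(hL C hC.1).1, hC.2⟩,
    hdis.mono (sep_subset _ _), hm i⟩, ?_⟩
  have hij : i + 1 ≠ i + 2 := fun h => by simp at h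
  have hdisj : Disjoint {C ∈ L | IsOfType P (i + 1) C} {C ∈ L | IsOfType P (i + 2) C} :=
    disjoint_left.2 fun C h h' => hij (h.2.unique h'.2)
  have hle : ({C ∈ L | IsOfType P (i + 1) C} ∪ {C ∈ L | IsOfType P (i + 2) C}).encard ≤
      hG.markedDist i := by
    have hsub : {C ∈ L | IsOfType P (i + 1) C} ∪ {C ∈ L | IsOfType P (i + 2) C} ⊆ L :=
      union_subset (sep_subset _ _) (sep_subset _ _)
    refine encard_le_dist (fun C hC => (hL C (hsub hC)).1) (hdis.mono hsub) fun C hC x hx y hy => ?_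
    rw [side_eq_of_mem_markedFace hG (hL C (hsub hC)).1 hx,
      side_eq_of_mem_markedFace hG (hL C (hsub hC)).1 hy]
    rcases hC with hC | hC
    · exact hC.2.side_ne hij.symm
    · exact (hC.2.side_ne hij).symm
  rw [encard_union_eq hdisj, hm, hm] at hle
  exact_mod_cast hle

theorem latticePolytope_subset [Finite ι] (hG : G.IsSigmaGraph P) :
    latticePolytope (G.maxLoops P) hG.markedDist ⊆ G.laminationSpace P := by
  intro m hm
  have hd : ∀ i j, i ≠ j →
      m i + m j ≤ G.faceGraph.dist (hG.markedFace i) (hG.markedFace j) := by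
    intro i j hij
    have : ∀ i j : Fin 3, i ≠ j →
        ∃ t : Fin 3, (i = t + 1 ∧ j = t + 2) ∨ (j = t + 1 ∧ i = t + 2) := by decide
    obtain ⟨t, ⟨rfl, rfl⟩ | ⟨rfl, rfl⟩⟩ := this i j hij
    · exact (hm t).2
    · rw [add_comm, SimpleGraph.dist_comm]
      exact (hm t).2
  choose D hD hDt hDv using fun (i : Fin 3) (k : Fin (m i)) =>
    exists_levelLoop hG (k.2.trans_le (hm i).1)
  -- At a common vertex some face has distance more than `k` and another at most `l`, and the
  -- distances differ by at most 1, so `k < l + 1`.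
  have hlevel : ∀ i (k l : Fin (m i)), ∀ v ∈ G.vert, v ∈ D i k → v ∈ D i l → k ≤ l := by
    intro i k l v hv hk hl
    obtain ⟨-, B, hB, hvB⟩ := hDv i k v hk
    obtain ⟨⟨A, hA, hvA⟩, -⟩ := hDv i l v hl
    have := dist_le_add_one (F := hG.markedFace i) hv hvA hvB
    exact Fin.le_def.2 (by omega)
  -- Since `k ≤ m i - 1` and `l ≤ m j - 1`, a common vertex would join the two marked faces by a
  -- path of length at most `(m i - 1) + 1 + (m j - 1)`, which is less than `m i + m j`.
  have hdiff : ∀ i j, i ≠ j → ∀ (k : Fin (m i)) (l : Fin (m j)), ∀ v ∈ G.vert,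
      v ∈ D i k → v ∉ D j l := by
    intro i j hij k l v hv hk hl
    obtain ⟨⟨A, hA, hvA⟩, -⟩ := hDv i k v hk
    obtain ⟨⟨B, hB, hvB⟩, -⟩ := hDv j l v hl
    have h1 := dist_le_add_one (F := hG.markedFace i) hv hvA hvB
    have : Nonempty G.faces := ⟨A⟩
    have hc : G.faceGraph.Connected := ⟨preconnected_faceGraph⟩
    have h2 := hc.dist_triangle (u := hG.markedFace i) (v := B) (w := hG.markedFace j)
    rw [SimpleGraph.dist_comm (u := B)] at h2
    have h3 := hd i j hij
    omega
  refine ⟨{C | ∃ i k, D i k = C}, ⟨?_, ?_⟩, fun i => ?_⟩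
  · rintro _ ⟨i, k, rfl⟩
    exact ⟨hD i k, not_isContractible_of_isOfType (hDt i k)⟩
  · rintro _ ⟨i, k, rfl⟩ _ ⟨j, l, rfl⟩ hne v hv ⟨h, h'⟩
    by_cases hij : i = j
    · subst hij
      exact hne (by rw [le_antisymm (hlevel i k l v hv h h') (hlevel i l k v hv h' h)])
    · exact hdiff i j hij k l v hv h h'
  · have hset : {C ∈ {C | ∃ i k, D i k = C} | IsOfType P i C} = range (D i) := by
      ext C
      constructor
      · rintro ⟨⟨j, k, rfl⟩, h⟩
        obtain rfl := h.unique (hDt j k)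
        exact mem_range_self k
      · rintro ⟨k, rfl⟩
        exact ⟨⟨i, k, rfl⟩, hDt i k⟩
    have hinj : Function.Injective (D i) := by
      intro k l h
      obtain ⟨v, hv, hvD⟩ := (hD i k).exists_mem_vert
      exact le_antisymm (hlevel i k l v hv hvD (h ▸ hvD)) (hlevel i l k v hv (h ▸ hvD) hvD)
    rw [hset, ← image_univ, hinj.encard_image, encard_univ]
    simp

end EmbeddedGraph

end Pants

/-- For a finite connected graph `G` on the sphere whose faces separate the three punctures, the
numbers `M_i` are attained maxima, the distances `d_i` are positive (so the marked faces are joined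
by face paths), and the lamination space is the lattice polytope given by the `M_i` and `d_i`. -/
theorem proposition1 {ι : Type*} [Finite ι] (P : Fin 3 → Pants.S2) (G : Pants.EmbeddedGraph ι)
    (hG : G.IsSigmaGraph P) :
    (∀ i, IsGreatest (G.loopCounts P i) (G.maxLoops P i)) ∧
    (∀ i, 0 < hG.markedDist i) ∧
    G.laminationSpace P = Pants.latticePolytope (G.maxLoops P) hG.markedDist := by
  refine ⟨Pants.EmbeddedGraph.isGreatest_maxLoops, fun i => ?_,
    (Pants.EmbeddedGraph.laminationSpace_subset hG).antisymm
      (Pants.EmbeddedGraph.latticePolytope_subset hG)⟩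
  refine (Pants.EmbeddedGraph.preconnected_faceGraph _ _).pos_dist_of_ne fun h => ?_
  have := hG.side_injective (congrArg Subtype.val h)
  simp at this
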